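/- Let $\mathcal M$ and $\mathcal U$ be separable real Hilbert spaces (finite- or infinite-dimensional), let $\mathcal Z=\mathbb R^{d_z}$ with the Euclidean norm, and let $p\ge 2$ be real. Let $\mu_m$ be a Borel probability measure on $\mathcal M$ with finite $p$-th moment $\mathbb E_{m\sim\mu_m}\|m\|_{\mathcal M}^p<\infty$, let $\mathcal Z_{ad}\subset\mathcal Z$ be compact and let $\mathcal B\supset\mathcal Z_{ad}$ be open. Let $u:\mathcal M\times\mathcal B\to\mathcal U$ be continuously Fréchet differentiable, and suppose that there are constants $\kappa_u,\kappa_{u_z}>0$ such that for all $z_1,z_2\in\mathcal B$ and $m_1,m_2\in\mathcal M$, $$\|u(m_2,z_2)-u(m_1,z_1)\|_{\mathcal U}\le\kappa_u\left(\|m_2-m_1\|_{\mathcal M}+\|z_2-z_1\|_{\mathcal Z}\right),$$ $$\|D_zu(m_2,z_2)-D_zu(m_1,z_1)\|_{\mathrm{HS}(\mathcal Z,\mathcal U)}\le\kappa_{u_z}\left(\|m_2-m_1\|_{\mathcal M}+\|z_2-z_1\|_{\mathcal Z}\right).$$ Here $D_z$ is the partial Fréchet derivative in $z$, and $\|A\|_{\mathrm{HS}(\mathcal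 Z,\mathcal U)}^2=\sum_i\|Av_i\|_{\mathcal U}^2$ for an orthonormal basis $(v_i)$ of $\mathcal Z$. Let $(\phi_i)_{i\ge1}$ and $(\psi_i)_{i\ge1}$ be any orthonormal bases of $\mathcal U$ and $\mathcal M$ (finite lists if the space is finite-dimensional). For integers $r_u,r_m\ge 0$ not exceeding the dimensions of $\mathcal U$, $\mathcal M$, put $\Phi_{r_u}c=\sum_{i=1}^{r_u}c_i\phi_i$ for $c\in\mathbb R^{r_u}$ and $\Psi_{r_m}^*m=(\langle m,\psi_i\rangle_{\mathcal M})_{i=1}^{r_m}\in\mathbb R^{r_m}$. A GELU network $g_\theta:\mathbb R^{n}\to\mathbb R^{k}$ is a map $a_0\mapsto a_{L+1}$ with $L\ge1$ hidden layers of arbitrary positive finite widths, given by $a_i=\sigma(W_{i-1}a_{i-1}+b_{i-1})$ for $1\le i\le L$ and $a_{L+1}=W_La_L+b_L$, with real weight matrices $W_i$ and bias vectors $b_i$, where $\sigma(x)=x\,\Phi_{\mathrm{Gauss}}(x)$ acts coordinatewise and $\Phi_{\mathrm{Gauss}}$ is the standard Gaussian distribution function. Then for all $b_u\in\mathcal U$,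 $b_m\in\mathcal M$ and every $\epsilon>0$ there exist ranks $r_m,r_u$ and a GELU network $g_\theta:\mathbb R^{r_m}\times\mathbb R^{d_z}\to\mathbb R^{r_u}$ such that the reduced-basis neural operator $$u_\theta(m,z)=\Phi_{r_u}\,g_\theta\left(\Psi_{r_m}^*(m-b_m),z\right)+b_u$$ satisfies $$\sup_{z\in\mathcal Z_{ad}}\left(\mathbb E_{m\sim\mu_m}\left[\|u(m,z)-u_\theta(m,z)\|_{\mathcal U}^p\right]+\mathbb E_{m\sim\mu_m}\left[\|D_zu(m,z)-D_zu_\theta(m,z)\|_{\mathrm{HS}(\mathcal Z,\mathcal U)}^p\right]\right)\le\epsilon^p .$$ -/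

import Mathlib

open MeasureTheory Topology

noncomputable section

namespace RBNO

/-- The Gaussian error linear unit `x ↦ x Φ(x)`, with `Φ` the distribution function of the
standard Gaussian law. -/
def gelu (x : ℝ) : ℝ :=
  x * ProbabilityTheory.cdf (ProbabilityTheory.gaussianReal 0 1) x

/-- The parameters (weight matrices and bias vectors) of a dense feedforward network.
`NetParams L n k` is the type of parameters of networks `ℝⁿ → ℝᵏ` with exactly `L` hidden layers,
the widths of the hidden layers being arbitrary positive integers. -/
inductive NetParams : ℕ → ℕ → ℕ → Type
  | output {n k : ℕ} (W : Matrix (Fin k) (Fin n) ℝ) (b : Fin k → ℝ) : NetParams 0 n k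
  | hidden {L n w k : ℕ} (hw : 0 < w) (W : Matrix (Fin w) (Fin n) ℝ) (b : Fin w → ℝ)
      (rest : NetParams L w k) : NetParams (L + 1) n k

/-- The function computed by a dense network with activation `σ` applied coordinatewise:
`a ↦ σ (W a + b)` in every hidden layer, and `a ↦ W a + b` in the output layer. -/
def NetParams.eval (σ : ℝ → ℝ) :
    {L n k : ℕ} → NetParams L n k → (Fin n → ℝ) → (Fin k → ℝ)
  | _, _, _, .output W b, a => W.mulVec a + b
  | _, _, _, .hidden _ W b rest, a => rest.eval σ (fun i => σ ((W.mulVec a + b) i))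

/-- The index set `{i | i < N}` of a countable orthonormal basis, where `N` is the dimension,
possibly infinite (for `N = ⊤` this is all of `ℕ`). -/
abbrev Idx (N : ℕ∞) : Type := {i : ℕ // (i : ℕ∞) < N}

section Bases

variable {X : Type*} [NormedAddCommGroup X] [InnerProductSpace ℝ X] {N : ℕ∞}

/-- The `i`-th vector, `i < r`, among the first `r` vectors of an orthonormal basis (`r` is at most
the dimension). -/
def basisVec (e : HilbertBasis (Idx N) ℝ X) (r : ℕ) (hr : (r : ℕ∞) ≤ N) (i : Fin r) : X :=
  e ⟨i, lt_of_lt_of_le (by exact_mod_cast i.isLt) hr⟩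

/-- Encoding `x ↦ (⟨x, eᵢ⟩)_{i < r}`. -/
def encode (e : HilbertBasis (Idx N) ℝ X) (r : ℕ) (hr : (r : ℕ∞) ≤ N) (x : X) : Fin r → ℝ :=
  fun i => inner ℝ x (basisVec e r hr i)

/-- Decoding `c ↦ ∑_{i < r} cᵢ eᵢ`. -/
def decode (e : HilbertBasis (Idx N) ℝ X) (r : ℕ) (hr : (r : ℕ∞) ≤ N) (c : Fin r → ℝ) : X :=
  ∑ i, c i • basisVec e r hr i

end Bases

section Operators

variable {M U : Type*} [NormedAddCommGroup M] [InnerProductSpace ℝ M]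
  [NormedAddCommGroup U] [InnerProductSpace ℝ U] {d : ℕ}

/-- The Hilbert–Schmidt norm of an operator from `ℝᵈ` to a Hilbert space. -/
def hsNorm (A : EuclideanSpace ℝ (Fin d) →L[ℝ] U) : ℝ :=
  √(∑ i, ‖A (EuclideanSpace.basisFun (Fin d) ℝ i)‖ ^ 2)

/-- The partial Fréchet derivative `D_z u (m, z)`. -/
def Dz (u : M → EuclideanSpace ℝ (Fin d) → U) (m : M) (z : EuclideanSpace ℝ (Fin d)) :
    EuclideanSpace ℝ (Fin d) →L[ℝ] U :=
  fderiv ℝ (u m) z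

/-- The reduced-basis neural operator `u_θ (m, z) = Φ g_θ (Ψ* (m - b_m), z) + b_u`, with `g_θ` the
GELU network with parameters `θ`. -/
def rbno {N_M N_U : ℕ∞} (φ : HilbertBasis (Idx N_U) ℝ U) (ψ : HilbertBasis (Idx N_M) ℝ M)
    (b_u : U) (b_m : M) (r_m r_u : ℕ) (hr_m : (r_m : ℕ∞) ≤ N_M) (hr_u : (r_u : ℕ∞) ≤ N_U)
    {L : ℕ} (θ : NetParams L (r_m + d) r_u) (m : M) (z : EuclideanSpace ℝ (Fin d)) : U :=
  decode φ r_u hr_u (θ.eval gelu (Fin.append (encode ψ r_m hr_m (m - b_m)) (fun j => z j))) + b_u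

/-- The standing assumptions on the solution operator `u`, the law `μ` of the random parameter, the
compact admissible set `Zad` and the open set `B`. Only the values of `u` on `M × B` matter. -/
structure SolutionOperatorAssumption [MeasurableSpace M] (p : ℝ) (μ : Measure M)
    (Zad B : Set (EuclideanSpace ℝ (Fin d))) (u : M → EuclideanSpace ℝ (Fin d) → U) : Prop where
  moment : Integrable (fun m : M => ‖m‖ ^ p) μ
  isCompact : IsCompact Zad
  isOpen : IsOpen B
  subset : Zad ⊆ B
  contDiffOn : ContDiffOn ℝ 1 (fun x : M × EuclideanSpace ℝ (Fin d) => u x.1 x.2)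
    (Set.univ ×ˢ B)
  lipschitz : ∃ κ : ℝ, 0 < κ ∧ ∀ z₁ ∈ B, ∀ z₂ ∈ B, ∀ m₁ m₂ : M,
    ‖u m₂ z₂ - u m₁ z₁‖ ≤ κ * (‖m₂ - m₁‖ + ‖z₂ - z₁‖)
  lipschitz_Dz : ∃ κ : ℝ, 0 < κ ∧ ∀ z₁ ∈ B, ∀ z₂ ∈ B, ∀ m₁ m₂ : M,
    hsNorm (Dz u m₂ z₂ - Dz u m₁ z₁) ≤ κ * (‖m₂ - m₁‖ + ‖z₂ - z₁‖)

end Operators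

end RBNO

end

namespace RBNO

section

open ProbabilityTheory Set Filter

/-! ### The Gaussian error linear unit -/

/-! The unbounded parameter is first replaced by one ranging over a compact set. Expand `m - b_m` in
the first `r` basis vectors and clip each coordinate to `[-k, k]`. As rank and threshold grow, these
reconstructions converge pointwise and stay dominated by `‖m - b_m‖`, so the finite moment makes
their `L^p` error small (`exists_truncation`). The two Lipschitz bounds carry this error over to `u`
and `D_z u`, uniformly in `z`. Only `z` is differentiated, so the kinks of `clip` do no harm.

Clipping is realized inside the network: GELU is at bounded distance from ReLU, so rescaled pairs of
neurons approximate `clip` uniformly on the line (`exists_gelu_approx_clip`), while `gelu x - gelu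
(-x) = x` carries `z` through exactly. The second hidden layer then sees only a compact cube times
`Zad`, so `C¹` approximation on compact sets suffices and the network cannot grow for large `m`.

That approximation is `approximable_of_contDiff_hasCompactSupport`. The second difference of GELU is
integrable and nonzero, so its Fourier transform is nonzero at some nonzero frequency; translates of
it therefore superpose to plane waves (`approximable_cexp`). Plane waves superpose to test functions
by Fourier inversion, and test functions to `C¹` functions by mollification. Each superposition is
an integral, which stays in the `C¹` closure of shallow networks (`approximable_integral`). A
shallow network has finitely many output weights in `U`, and these are moved into the span of the
first `r_u` basis vectors (`exists_decode_approx_prod`). -/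

theorem gaussianPDFReal_zero_one (x : ℝ) :
    gaussianPDFReal 0 1 x = (√(2 * Real.pi))⁻¹ * Real.exp (-x ^ 2 / 2) := by
  simp [gaussianPDFReal]

theorem hasDerivAt_gaussianPDFReal_zero_one (x : ℝ) :
    HasDerivAt (gaussianPDFReal 0 1) (-x * gaussianPDFReal 0 1 x) x := by
  have h : gaussianPDFReal 0 1 = fun x => (√(2 * Real.pi))⁻¹ * Real.exp (-x ^ 2 / 2) :=
    funext gaussianPDFReal_zero_one
  rw [h]
  have h1 : HasDerivAt (fun x : ℝ => -x ^ 2 / 2) (-x) x := by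
    refine ((hasDerivAt_pow 2 x).neg.div_const 2).congr_deriv ?_
    norm_num
    ring
  refine (h1.exp.const_mul (√(2 * Real.pi))⁻¹).congr_deriv ?_
  ring

theorem continuous_gaussianPDFReal_zero_one : Continuous (gaussianPDFReal 0 1) :=
  continuous_iff_continuousAt.2 fun x => (hasDerivAt_gaussianPDFReal_zero_one x).continuousAt

theorem cdf_gaussianReal_eq_integral (x : ℝ) :
    cdf (gaussianReal 0 1) x = ∫ t in Iic x, gaussianPDFReal 0 1 t := by
  rw [cdf_eq_real, measureReal_def, gaussianReal_apply_eq_integral _ one_ne_zero,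
    ENNReal.toReal_ofReal]
  exact setIntegral_nonneg measurableSet_Iic fun t _ => gaussianPDFReal_nonneg 0 1 t

theorem hasDerivAt_cdf_gaussianReal (x : ℝ) :
    HasDerivAt (cdf (gaussianReal 0 1)) (gaussianPDFReal 0 1 x) x := by
  have hi : ∀ y : ℝ, IntegrableOn (gaussianPDFReal 0 1) (Iic y) := fun y =>
    (integrable_gaussianPDFReal 0 1).integrableOn
  have h : ∀ y : ℝ, cdf (gaussianReal 0 1) y
      = (∫ t in (0 : ℝ)..y, gaussianPDFReal 0 1 t) + cdf (gaussianReal 0 1) 0 := by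
    intro y
    rw [cdf_gaussianReal_eq_integral, cdf_gaussianReal_eq_integral,
      ← intervalIntegral.integral_Iic_sub_Iic (hi 0) (hi y)]
    ring
  rw [show (cdf (gaussianReal 0 1) : ℝ → ℝ) = _ from funext h]
  exact ((continuous_gaussianPDFReal_zero_one.integral_hasStrictDerivAt 0 x).hasDerivAt).add_const _

theorem cdf_gaussianReal_neg (x : ℝ) :
    cdf (gaussianReal 0 1) (-x) = 1 - cdf (gaussianReal 0 1) x := by
  have hmap : (gaussianReal 0 1).map (fun y : ℝ => -y) = gaussianReal 0 1 := by
    rw [gaussianReal_map_neg, neg_zero]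
  have h1 : (gaussianReal 0 1).real (Iic (-x)) = (gaussianReal 0 1).real (Ioi x) := by
    have : (gaussianReal 0 1) (Iic (-x)) = (gaussianReal 0 1) (Ici x) := by
      conv_lhs => rw [← hmap]
      rw [Measure.map_apply measurable_neg measurableSet_Iic]
      congr 1
      ext y
      simp
    rw [measureReal_def, this, measureReal_def]
    have := nullSingletonClass_gaussianReal (μ := 0) (v := 1) one_ne_zero
    rw [measure_congr Ioi_ae_eq_Ici]
  rw [cdf_eq_real, cdf_eq_real, h1, ← compl_Iic, probReal_compl_eq_one_sub measurableSet_Iic]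

/-- By symmetry of the Gaussian law. Two neurons thus reproduce the identity without error,
including its derivative. -/
theorem gelu_sub_gelu_neg (x : ℝ) : gelu x - gelu (-x) = x := by
  simp only [gelu, cdf_gaussianReal_neg]
  ring

/-- The derivative of `gelu`. -/
noncomputable def geluDeriv (x : ℝ) : ℝ :=
  cdf (gaussianReal 0 1) x + x * gaussianPDFReal 0 1 x

theorem hasDerivAt_gelu (x : ℝ) : HasDerivAt gelu (geluDeriv x) x := by
  have := (hasDerivAt_id x).mul (hasDerivAt_cdf_gaussianReal x)
  simpa [gelu, geluDeriv] using! this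

theorem hasDerivAt_geluDeriv (x : ℝ) :
    HasDerivAt geluDeriv ((2 - x ^ 2) * gaussianPDFReal 0 1 x) x := by
  have := (hasDerivAt_cdf_gaussianReal x).add
    ((hasDerivAt_id x).mul (hasDerivAt_gaussianPDFReal_zero_one x))
  refine HasDerivAt.congr_deriv this ?_
  simp
  ring

theorem hasDerivAt_geluDeriv_two (x : ℝ) :
    HasDerivAt (fun x => (2 - x ^ 2) * gaussianPDFReal 0 1 x)
      ((x ^ 3 - 4 * x) * gaussianPDFReal 0 1 x) x := by
  have := ((hasDerivAt_pow 2 x).const_sub 2).mul (hasDerivAt_gaussianPDFReal_zero_one x)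
  refine HasDerivAt.congr_deriv this ?_
  simp
  ring

theorem continuous_geluDeriv : Continuous geluDeriv :=
  continuous_iff_continuousAt.2 fun x => (hasDerivAt_geluDeriv x).continuousAt

theorem contDiff_one_of_hasDerivAt {f f' : ℝ → ℝ} (h : ∀ x, HasDerivAt f (f' x) x)
    (h' : Continuous f') : ContDiff ℝ 1 f :=
  contDiff_one_iff_deriv.2 ⟨fun x => (h x).differentiableAt, by
    rwa [show deriv f = f' from funext fun x => (h x).deriv]⟩

theorem contDiff_gelu : ContDiff ℝ 1 gelu :=
  contDiff_one_of_hasDerivAt hasDerivAt_gelu continuous_geluDeriv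

/-- Markov's inequality for `|t|`; the left side is the gap between GELU and ReLU at `x` and at
`-x`. -/
theorem mul_gaussianReal_Iic_neg_le (x : ℝ) (hx : 0 ≤ x) :
    x * (gaussianReal 0 1).real (Iic (-x)) ≤ ∫ t, |t| ∂(gaussianReal 0 1) := by
  have hint : Integrable (fun t : ℝ => |t|) (gaussianReal 0 1) := by
    have := (memLp_id_gaussianReal (μ := 0) (v := 1) 1).integrable (by norm_num)
    exact this.abs
  refine le_trans ?_ (mul_meas_ge_le_integral_of_nonneg
    (ae_of_all _ fun t => abs_nonneg t) hint x)
  refine mul_le_mul_of_nonneg_left (measureReal_mono ?_) hx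
  intro t ht
  have ht' : t ≤ -x := ht
  have hxt : x ≤ -t := by linarith
  exact hxt.trans (neg_le_abs t)

/-- `gelu` stays at bounded distance from the rectified linear unit. -/
theorem exists_abs_gelu_sub_relu_le : ∃ C, 0 < C ∧ ∀ x : ℝ, |gelu x - max x 0| ≤ C := by
  refine ⟨(∫ t, |t| ∂(gaussianReal 0 1)) + 1, ?_, fun x => ?_⟩
  · have : 0 ≤ ∫ t, |t| ∂(gaussianReal 0 1) := integral_nonneg fun t => abs_nonneg t
    linarith
  rcases le_total 0 x with hx | hx
  · have h := mul_gaussianReal_Iic_neg_le x hx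
    rw [← cdf_eq_real] at h
    have h0 : gelu x - max x 0 = -(x * cdf (gaussianReal 0 1) (-x)) := by
      rw [max_eq_left hx, cdf_gaussianReal_neg, gelu]
      ring
    rw [h0, abs_neg, abs_of_nonneg (mul_nonneg hx (cdf_nonneg _ _))]
    linarith
  · have h := mul_gaussianReal_Iic_neg_le (-x) (by linarith)
    rw [← cdf_eq_real, neg_neg] at h
    have h0 : gelu x - max x 0 = -(-x * cdf (gaussianReal 0 1) x) := by
      rw [max_eq_right hx, gelu]
      ring
    rw [h0, abs_neg, abs_of_nonneg (mul_nonneg (by linarith) (cdf_nonneg _ _))]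
    linarith

/-- From the cubic term of the exponential series. The third power leaves decay `1 / (1 + x ^ 2)`
after multiplication by the polynomial factors in the second and third derivatives of GELU. -/
theorem gaussianPDFReal_zero_one_le (x : ℝ) :
    gaussianPDFReal 0 1 x ≤ 200 / (1 + x ^ 2) ^ 3 := by
  have h1 : gaussianPDFReal 0 1 x ≤ Real.exp (-x ^ 2 / 2) := by
    rw [gaussianPDFReal_zero_one]
    refine mul_le_of_le_one_left (Real.exp_pos _).le (inv_le_one_of_one_le₀ ?_)
    rw [Real.one_le_sqrt]
    nlinarith [Real.pi_gt_three]
  refine h1.trans ?_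
  rw [neg_div, Real.exp_neg, inv_eq_one_div, div_le_div_iff₀ (Real.exp_pos _) (by positivity)]
  have h3 := Real.pow_div_factorial_le_exp (x ^ 2 / 2) (by positivity) 3
  have h4 := Real.one_le_exp (x := x ^ 2 / 2) (by positivity)
  have h5 : (x ^ 2) ^ 3 ≤ 48 * Real.exp (x ^ 2 / 2) := by
    norm_num [Nat.factorial] at h3
    nlinarith
  have hs : 0 ≤ x ^ 2 := sq_nonneg x
  nlinarith [mul_nonneg (by positivity : 0 ≤ 1 + x ^ 2) (sq_nonneg (x ^ 2 - 1))]

/-- The central second difference with unit step. -/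
def secondDiff (f : ℝ → ℝ) (x : ℝ) : ℝ := f (x + 1) - 2 * f x + f (x - 1)

/-- Three uses of the mean value theorem give `f'' y * (a - b)` with `|x - y| ≤ 1` and `a - b ≤ 2`.
Moving the weight from `y` to `x` costs the factor 3. -/
theorem abs_secondDiff_le {f f' f'' : ℝ → ℝ} (hf : ∀ x, HasDerivAt f (f' x) x)
    (hf' : ∀ x, HasDerivAt f' (f'' x) x) {C : ℝ} (hC : ∀ x, |f'' x| ≤ C / (1 + x ^ 2)) (x : ℝ) :
    |secondDiff f x| ≤ 6 * C / (1 + x ^ 2) := by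
  have hc : ∀ a b, ContinuousOn f (Icc a b) := fun a b y _ => (hf y).continuousAt.continuousWithinAt
  obtain ⟨a, ha, ha'⟩ := exists_hasDerivAt_eq_slope f f' (show x < x + 1 by linarith) (hc _ _)
    fun y _ => hf y
  obtain ⟨b, hb, hb'⟩ := exists_hasDerivAt_eq_slope f f' (show x - 1 < x by linarith) (hc _ _)
    fun y _ => hf y
  have hab : b < a := hb.2.trans ha.1
  obtain ⟨y, hy, hy'⟩ := exists_hasDerivAt_eq_slope f' f'' hab
    (fun y _ => (hf' y).continuousAt.continuousWithinAt) fun y _ => hf' y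
  have hba : 0 < a - b := by linarith
  have hsd : secondDiff f x = f'' y * (a - b) := by
    rw [hy', div_mul_cancel₀ _ hba.ne', ha', hb', secondDiff]
    simp only [add_sub_cancel_left, sub_sub_cancel, div_one]
    ring
  have hC0 : 0 ≤ C := by
    have := (abs_nonneg _).trans (hC 0)
    simpa using this
  have h2 : a - b ≤ 2 := by linarith [ha.2, hb.1]
  have hxy : |x - y| ≤ 1 := abs_le.2 ⟨by linarith [hy.2, ha.2], by linarith [hy.1, hb.1]⟩
  have hxy2 : (x - y) ^ 2 ≤ 1 := by
    rw [← sq_abs]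
    nlinarith [abs_nonneg (x - y)]
  have h3 : 1 + x ^ 2 ≤ 3 * (1 + y ^ 2) := by nlinarith [sq_nonneg (x - 2 * y)]
  rw [hsd, abs_mul, abs_of_pos hba]
  calc |f'' y| * (a - b) ≤ C / (1 + y ^ 2) * 2 :=
        mul_le_mul (hC y) h2 hba.le (by positivity)
    _ ≤ 6 * C / (1 + x ^ 2) := by
        rw [div_mul_eq_mul_div, div_le_div_iff₀ (by positivity) (by positivity)]
        nlinarith

theorem abs_secondDiff_gelu_le (x : ℝ) : |secondDiff gelu x| ≤ 6 * 800 / (1 + x ^ 2) := by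
  refine abs_secondDiff_le hasDerivAt_gelu hasDerivAt_geluDeriv (fun y => ?_) x
  rw [abs_mul, abs_of_nonneg (gaussianPDFReal_nonneg 0 1 y)]
  have h1 : |2 - y ^ 2| ≤ 2 * (1 + y ^ 2) := abs_le.2 ⟨by nlinarith, by nlinarith⟩
  calc |2 - y ^ 2| * gaussianPDFReal 0 1 y ≤ 2 * (1 + y ^ 2) * (200 / (1 + y ^ 2) ^ 3) :=
        mul_le_mul h1 (gaussianPDFReal_zero_one_le y) (gaussianPDFReal_nonneg 0 1 y)
          (by positivity)
    _ ≤ 800 / (1 + y ^ 2) := by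
        rw [mul_div_assoc', div_le_div_iff₀ (by positivity) (by positivity)]
        have h1 : (1 + y ^ 2) ^ 2 ≤ (1 + y ^ 2) ^ 3 :=
          pow_le_pow_right₀ (by nlinarith) (by norm_num)
        nlinarith [pow_pos (show 0 < 1 + y ^ 2 by positivity) 3]

theorem abs_secondDiff_geluDeriv_le (x : ℝ) :
    |secondDiff geluDeriv x| ≤ 6 * 800 / (1 + x ^ 2) := by
  refine abs_secondDiff_le hasDerivAt_geluDeriv hasDerivAt_geluDeriv_two (fun y => ?_) x
  rw [abs_mul, abs_of_nonneg (gaussianPDFReal_nonneg 0 1 y)]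
  have h1 : |y ^ 3 - 4 * y| ≤ 4 * (1 + y ^ 2) ^ 2 :=
    abs_le.2 ⟨by nlinarith [sq_nonneg (y ^ 2 + y), sq_nonneg (y - 1), sq_nonneg (y + 1)],
      by nlinarith [sq_nonneg (y ^ 2 - y), sq_nonneg (y - 1), sq_nonneg (y + 1)]⟩
  calc |y ^ 3 - 4 * y| * gaussianPDFReal 0 1 y ≤ 4 * (1 + y ^ 2) ^ 2 * (200 / (1 + y ^ 2) ^ 3) :=
        mul_le_mul h1 (gaussianPDFReal_zero_one_le y) (gaussianPDFReal_nonneg 0 1 y)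
          (by positivity)
    _ ≤ 800 / (1 + y ^ 2) := by
        rw [mul_div_assoc', div_le_div_iff₀ (by positivity) (by positivity)]
        exact le_of_eq (by ring)

theorem hasDerivAt_secondDiff {f f' : ℝ → ℝ} (hf : ∀ x, HasDerivAt f (f' x) x) (x : ℝ) :
    HasDerivAt (secondDiff f) (secondDiff f' x) x :=
  (((hf (x + 1)).comp_add_const x 1).sub ((hf x).const_mul 2)).add
    ((hf (x - 1)).comp_sub_const x 1)

theorem continuous_secondDiff {f : ℝ → ℝ} (hf : Continuous f) : Continuous (secondDiff f) := by
  unfold secondDiff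
  fun_prop

theorem integrable_secondDiff_gelu : Integrable (secondDiff gelu) := by
  refine (integrable_inv_one_add_sq.const_mul (6 * 800)).mono'
    (continuous_secondDiff contDiff_gelu.continuous).aestronglyMeasurable (ae_of_all _ fun x => ?_)
  rw [Real.norm_eq_abs, ← div_eq_mul_inv]
  exact abs_secondDiff_gelu_le x

/-- The value is `2 Φ(1) - 1`, and `Φ(1) > Φ(0) = 1/2`. -/
theorem secondDiff_gelu_zero_pos : 0 < secondDiff gelu 0 := by
  have h0 : cdf (gaussianReal 0 1) 0 = 1 / 2 := by
    have := cdf_gaussianReal_neg 0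
    rw [neg_zero] at this
    linarith
  have h1 : cdf (gaussianReal 0 1) 0 < cdf (gaussianReal 0 1) 1 := by
    refine strictMono_of_deriv_pos (fun x => ?_) one_pos
    rw [(hasDerivAt_cdf_gaussianReal x).deriv]
    exact gaussianPDFReal_pos 0 1 x one_ne_zero
  simp only [secondDiff, gelu, zero_add, zero_sub, cdf_gaussianReal_neg]
  linarith

-- Otherwise the Fourier transform vanishes almost everywhere, and inversion forces the continuous
-- integrable function `secondDiff gelu` to vanish at 0. The frequency must be nonzero because plane
-- waves are obtained by rescaling with `w⁻¹`.
open FourierTransform in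
theorem exists_fourier_secondDiff_gelu_ne_zero :
    ∃ w : ℝ, w ≠ 0 ∧
      ∫ s : ℝ, Complex.exp ((w * s : ℝ) * Complex.I) * (secondDiff gelu s : ℂ) ≠ 0 := by
  by_contra! h
  set g : ℝ → ℂ := fun s => (secondDiff gelu s : ℂ) with hg
  have hgc : Continuous g :=
    Complex.continuous_ofReal.comp (continuous_secondDiff contDiff_gelu.continuous)
  have hgi : Integrable g := integrable_secondDiff_gelu.ofReal
  have hF : 𝓕 g =ᵐ[volume] 0 := by
    filter_upwards [compl_mem_ae_iff.2 (measure_singleton (0 : ℝ))] with w hw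
    have hw0 : -2 * Real.pi * w ≠ 0 := by simpa [Real.pi_ne_zero] using hw
    rw [Real.fourier_eq', Pi.zero_apply, ← h _ hw0]
    congr 1
    ext s
    rw [smul_eq_mul]
    congr 4
    simp
    ring
  have := congrFun (hgc.fourierInv_fourier_eq hgi ((integrable_zero _ _ _).congr hF.symm)) 0
  have h0 : g 0 = 0 := by
    rw [← this, Real.fourierInv_eq']
    refine integral_eq_zero_of_ae ?_
    filter_upwards [hF] with w hw
    simp [hw]
  exact secondDiff_gelu_zero_pos.ne' (by simpa [hg] using h0)

end

/-! ### Bochner integrals and closed subspaces -/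

section

open Set Filter Metric

/-- Hahn–Banach: a functional separating the integral from `S` is bounded above on a subspace, hence
zero there, hence zero on the integral. -/
theorem integral_mem_of_isClosed_submodule {E Y : Type*} [NormedAddCommGroup E] [NormedSpace ℝ E]
    [CompleteSpace E] [MeasurableSpace Y] {ν : Measure Y} (S : Submodule ℝ E)
    (hS : IsClosed (S : Set E)) {c : Y → E} (hc : Integrable c ν) (hcS : ∀ y, c y ∈ S) :
    ∫ y, c y ∂ν ∈ S := by
  by_contra h
  obtain ⟨f, u, hf, hu⟩ := geometric_hahn_banach_closed_point S.convex hS h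
  have h0 : ∀ x ∈ S, f x = 0 := by
    intro x hx
    by_contra hne
    have := hf ((u / f x) • x) (S.smul_mem _ hx)
    rw [map_smul, smul_eq_mul, div_mul_cancel₀ _ hne] at this
    exact lt_irrefl _ this
  have h1 : f (∫ y, c y ∂ν) = 0 := by
    rw [← f.integral_comp_comm hc]
    simp [h0 _ (hcS _)]
  have h2 := hf 0 S.zero_mem
  rw [map_zero] at h2
  linarith

/-- Curried, `c` is a Bochner integrable map into `C(K, W)` whose values lie in the closure of `S`,
so its integral does too. This replaces uniform estimates on Riemann sums. -/
theorem exists_mem_approx_integral {W Y K : Type*} [NormedAddCommGroup W] [NormedSpace ℝ W]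
    [CompleteSpace W] [TopologicalSpace K] [CompactSpace K] [TopologicalSpace Y]
    [SecondCountableTopology Y] [MeasurableSpace Y] [BorelSpace Y] {ν : Measure Y}
    (S : Submodule ℝ (K → W)) (hS : ∀ s ∈ S, Continuous s) {c : Y → K → W}
    (hc : Continuous fun q : Y × K => c q.1 q.2) {b : Y → ℝ} (hb : Integrable b ν)
    (hcb : ∀ y k, ‖c y k‖ ≤ b y)
    (hcS : ∀ y, ∀ ε > 0, ∃ s ∈ S, ∀ k, ‖c y k - s k‖ ≤ ε) {ε : ℝ} (hε : 0 < ε) :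
    ∃ s ∈ S, ∀ k, ‖(∫ y, c y k ∂ν) - s k‖ ≤ ε := by
  let S' : Submodule ℝ C(K, W) := S.comap (ContinuousMap.coeFnLinearMap ℝ)
  let c' : C(Y, C(K, W)) := ContinuousMap.curry ⟨fun q : Y × K => c q.1 q.2, hc⟩
  have hci : Integrable c' ν := by
    refine hb.norm.mono' c'.continuous.aestronglyMeasurable (ae_of_all _ fun y => ?_)
    exact (ContinuousMap.norm_le _ (norm_nonneg _)).2 fun k => (hcb y k).trans (le_abs_self _)
  have hmem : ∫ y, c' y ∂ν ∈ S'.topologicalClosure := by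
    refine integral_mem_of_isClosed_submodule _ S'.isClosed_topologicalClosure hci fun y => ?_
    rw [← SetLike.mem_coe, Submodule.topologicalClosure_coe, Metric.mem_closure_iff]
    intro δ hδ
    obtain ⟨s, hs, hsc⟩ := hcS y (δ / 2) (half_pos hδ)
    refine ⟨⟨s, hS s hs⟩, hs, lt_of_le_of_lt ?_ (half_lt_self hδ)⟩
    refine (ContinuousMap.dist_le (half_pos hδ).le).2 fun k => ?_
    rw [dist_eq_norm]
    exact hsc k
  rw [← SetLike.mem_coe, Submodule.topologicalClosure_coe, Metric.mem_closure_iff] at hmem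
  obtain ⟨s, hs, hd⟩ := hmem ε hε
  refine ⟨s, hs, fun k => ?_⟩
  have h1 : (∫ y, c' y ∂ν) k = ∫ y, c y k ∂ν :=
    ((ContinuousMap.evalCLM ℝ k).integral_comp_comm hci).symm
  have := (ContinuousMap.dist_apply_le_dist k).trans hd.le
  rwa [dist_eq_norm, h1] at this

/-! ### Approximation by shallow networks -/

section Shallow

variable {X U V : Type*} [NormedAddCommGroup X] [InnerProductSpace ℝ X]
  [NormedAddCommGroup U] [NormedSpace ℝ U] [NormedAddCommGroup V] [NormedSpace ℝ V]

variable (X U) in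
/-- The `U`-valued networks on `X` with one hidden layer. -/
def Shallow : Submodule ℝ (X → U) :=
  Submodule.span ℝ {h | ∃ (ℓ : X →L[ℝ] ℝ) (b : ℝ) (c : U), h = fun x => gelu (ℓ x + b) • c}

theorem contDiff_neuron (ℓ : X →L[ℝ] ℝ) (b : ℝ) (c : U) :
    ContDiff ℝ 1 (fun x => gelu (ℓ x + b) • c) :=
  (contDiff_gelu.comp (ℓ.contDiff.add contDiff_const)).smul contDiff_const

theorem contDiff_of_mem_shallow {h : X → U} (hh : h ∈ Shallow X U) : ContDiff ℝ 1 h := by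
  induction hh using Submodule.span_induction with
  | mem h hh =>
    obtain ⟨ℓ, b, c, rfl⟩ := hh
    exact contDiff_neuron ℓ b c
  | zero => exact contDiff_const
  | add f g _ _ hf hg => exact hf.add hg
  | smul a f _ hf => exact contDiff_const.smul hf

theorem comp_mem_shallow (T : U →L[ℝ] V) {h : X → U} (hh : h ∈ Shallow X U) :
    (fun x => T (h x)) ∈ Shallow X V := by
  induction hh using Submodule.span_induction with
  | mem h hh =>
    obtain ⟨ℓ, b, c, rfl⟩ := hh
    refine Submodule.subset_span ⟨ℓ, b, T c, ?_⟩
    ext x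
    simp
  | zero =>
    convert (Shallow X V).zero_mem using 1
    ext x
    simp
  | add f g _ _ hf hg => simpa using! (Shallow X V).add_mem hf hg
  | smul a f _ hf => simpa using! (Shallow X V).smul_mem a hf

/-- `f` and its derivative are uniform limits, on every ball, of shallow networks and their
derivatives. -/
def Approximable (f : X → U) : Prop :=
  ∀ R ε : ℝ, 0 < ε → ∃ h ∈ Shallow X U, ∀ x, ‖x‖ ≤ R →
    ‖f x - h x‖ ≤ ε ∧ ‖fderiv ℝ f x - fderiv ℝ h x‖ ≤ ε

theorem approximable_of_mem_shallow {h : X → U} (hh : h ∈ Shallow X U) : Approximable h :=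
  fun R ε hε => ⟨h, hh, fun x _ => by simp [hε.le]⟩

theorem approximable_of_forall_exists {f : X → U}
    (h : ∀ R ε : ℝ, 0 < ε → ∃ g, Approximable g ∧ ∀ x, ‖x‖ ≤ R →
      ‖f x - g x‖ ≤ ε ∧ ‖fderiv ℝ f x - fderiv ℝ g x‖ ≤ ε) : Approximable f := by
  intro R ε hε
  obtain ⟨g, hg, hfg⟩ := h R (ε / 2) (half_pos hε)
  obtain ⟨k, hk, hgk⟩ := hg R (ε / 2) (half_pos hε)
  refine ⟨k, hk, fun x hx => ⟨?_, ?_⟩⟩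
  · calc ‖f x - k x‖ ≤ ‖f x - g x‖ + ‖g x - k x‖ := norm_sub_le_norm_sub_add_norm_sub _ _ _
      _ ≤ ε / 2 + ε / 2 := add_le_add (hfg x hx).1 (hgk x hx).1
      _ = ε := add_halves ε
  · calc ‖fderiv ℝ f x - fderiv ℝ k x‖
        ≤ ‖fderiv ℝ f x - fderiv ℝ g x‖ + ‖fderiv ℝ g x - fderiv ℝ k x‖ :=
          norm_sub_le_norm_sub_add_norm_sub _ _ _
      _ ≤ ε / 2 + ε / 2 := add_le_add (hfg x hx).2 (hgk x hx).2
      _ = ε := add_halves ε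

theorem Approximable.clm_comp {f : X → U} (hf : Approximable f) (hfd : Differentiable ℝ f)
    (T : U →L[ℝ] V) : Approximable (fun x => T (f x)) := by
  intro R ε hε
  have hT : 0 < ‖T‖ + 1 := by positivity
  obtain ⟨h, hh, hfh⟩ := hf R (ε / (‖T‖ + 1)) (div_pos hε hT)
  have hle : ‖T‖ * (ε / (‖T‖ + 1)) ≤ ε := by
    rw [mul_div_assoc', div_le_iff₀ hT]
    nlinarith
  refine ⟨_, comp_mem_shallow T hh, fun x hx => ⟨?_, ?_⟩⟩
  · rw [← map_sub]
    exact (T.le_opNorm_of_le (hfh x hx).1).trans hle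
  · have h1 : fderiv ℝ (fun x => T (f x)) x = T.comp (fderiv ℝ f x) :=
      (T.hasFDerivAt.comp x (hfd x).hasFDerivAt).fderiv
    have h2 : fderiv ℝ (fun x => T (h x)) x = T.comp (fderiv ℝ h x) :=
      (T.hasFDerivAt.comp x
        ((contDiff_of_mem_shallow hh).differentiable one_ne_zero x).hasFDerivAt).fderiv
    rw [h1, h2, ← ContinuousLinearMap.comp_sub]
    exact (T.opNorm_comp_le _).trans
      ((mul_le_mul_of_nonneg_left (hfh x hx).2 (norm_nonneg T)).trans hle)

variable [FiniteDimensional ℝ X]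

variable (X U) in
/-- Shallow networks on a ball, together with their derivatives. -/
def shallowJets (R : ℝ) : Submodule ℝ (closedBall (0 : X) R → U × (X →L[ℝ] U)) where
  carrier := {e | ∃ h ∈ Shallow X U, ∀ x, e x = (h x, fderiv ℝ h x)}
  zero_mem' := ⟨0, Submodule.zero_mem _, fun x => by
    simp only [Pi.zero_apply, fderiv_zero]
    rfl⟩
  add_mem' := by
    rintro e e' ⟨h, hh, he⟩ ⟨h', hh', he'⟩
    refine ⟨h + h', Submodule.add_mem _ hh hh', fun x => ?_⟩
    rw [fderiv_add ((contDiff_of_mem_shallow hh).differentiable one_ne_zero x)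
        ((contDiff_of_mem_shallow hh').differentiable one_ne_zero x)]
    simp [he x, he' x]
  smul_mem' := by
    rintro a e ⟨h, hh, he⟩
    refine ⟨a • h, Submodule.smul_mem _ a hh, fun x => ?_⟩
    rw [fderiv_const_smul ((contDiff_of_mem_shallow hh).differentiable one_ne_zero x)]
    simp [he x]

/-- A parametric integral of approximable functions is approximable. -/
theorem approximable_integral [CompleteSpace U] {Y : Type*} [TopologicalSpace Y]
    [SecondCountableTopology Y] [MeasurableSpace Y] [BorelSpace Y] {ν : Measure Y}
    {F : Y → X → U} (hF : ∀ y, Approximable (F y)) (hFd : ∀ y, Differentiable ℝ (F y))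
    (hc : Continuous fun q : Y × X => F q.1 q.2)
    (hc' : Continuous fun q : Y × X => fderiv ℝ (F q.1) q.2)
    (hb : ∀ R : ℝ, ∃ b : Y → ℝ, Integrable b ν ∧ ∀ y x, ‖x‖ ≤ R →
      ‖F y x‖ ≤ b y ∧ ‖fderiv ℝ (F y) x‖ ≤ b y) :
    Approximable (fun x => ∫ y, F y x ∂ν) := by
  intro R ε hε
  have := isCompact_iff_compactSpace.1 (isCompact_closedBall (0 : X) R)
  have hv : Continuous fun q : Y × closedBall (0 : X) R => ((q.1, (q.2 : X)) : Y × X) := by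
    fun_prop
  obtain ⟨b, hbi, hbb⟩ := hb R
  obtain ⟨s, ⟨h, hh, hs⟩, hsc⟩ := exists_mem_approx_integral (ν := ν) (shallowJets X U R)
    (by
      rintro s ⟨h, hh, hs⟩
      have hc := contDiff_of_mem_shallow hh
      rw [show s = _ from funext hs]
      exact (hc.continuous.comp continuous_subtype_val).prodMk
        ((hc.continuous_fderiv one_ne_zero).comp continuous_subtype_val))
    (c := fun y x => (F y x, fderiv ℝ (F y) x)) ((hc.comp hv).prodMk (hc'.comp hv)) hbi
    (fun y x => max_le (hbb y x (mem_closedBall_zero_iff.1 x.2)).1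
      (hbb y x (mem_closedBall_zero_iff.1 x.2)).2)
    (fun y δ hδ => by
      obtain ⟨h, hh, hFh⟩ := hF y R δ hδ
      exact ⟨fun x => (h x, fderiv ℝ h x), ⟨h, hh, fun x => rfl⟩, fun x =>
        max_le (hFh x (mem_closedBall_zero_iff.1 x.2)).1
          (hFh x (mem_closedBall_zero_iff.1 x.2)).2⟩) hε
  have hm : ∀ z : X, AEStronglyMeasurable (fun y => F y z) ν := fun z =>
    (hc.comp (by fun_prop : Continuous fun y : Y => (y, z))).aestronglyMeasurable
  have hm' : ∀ z : X, AEStronglyMeasurable (fun y => fderiv ℝ (F y) z) ν := fun z =>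
    (hc'.comp (by fun_prop : Continuous fun y : Y => (y, z))).aestronglyMeasurable
  refine ⟨h, hh, fun x hx => ?_⟩
  have hi : Integrable (fun y => F y x) ν :=
    hbi.mono' (hm x) (ae_of_all _ fun y => (hbb y x hx).1)
  have hi' : Integrable (fun y => fderiv ℝ (F y) x) ν :=
    hbi.mono' (hm' x) (ae_of_all _ fun y => (hbb y x hx).2)
  have hsx := hsc ⟨x, mem_closedBall_zero_iff.2 hx⟩
  rw [hs, integral_pair hi hi', Prod.mk_sub_mk, Prod.norm_def, max_le_iff] at hsx
  refine ⟨hsx.1, ?_⟩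
  have hd : fderiv ℝ (fun x => ∫ y, F y x ∂ν) x = ∫ y, fderiv ℝ (F y) x ∂ν := by
    -- Differentiation under the integral needs domination on a neighbourhood of `x`, which may
    -- leave the ball of radius `R`.
    obtain ⟨b', hbi', hbb'⟩ := hb (‖x‖ + 1)
    refine (hasFDerivAt_integral_of_dominated_of_fderiv_le (𝕜 := ℝ)
      (F' := fun z y => fderiv ℝ (F y) z)
      (ball_mem_nhds x one_pos) (Eventually.of_forall hm) hi (hm' x)
      (ae_of_all _ fun y z hz => (hbb' y z ?_).2) hbi'
      (ae_of_all _ fun y z _ => (hFd y z).hasFDerivAt)).fderiv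
    have hzx : ‖z - x‖ < 1 := by rwa [mem_ball, dist_eq_norm] at hz
    have := norm_le_norm_add_norm_sub' z x
    linarith
  rw [hd]
  exact hsx.2

end Shallow

end

/-! ### Universal approximation in `C¹`: plane waves, test functions, mollification -/

section

open Set Filter Metric

section Density

variable {X U : Type*} [NormedAddCommGroup X] [InnerProductSpace ℝ X]
  [NormedAddCommGroup U] [NormedSpace ℝ U]

theorem secondDiff_gelu_mem_shallow (ℓ : X →L[ℝ] ℝ) (b : ℝ) (c : U) :
    (fun x => secondDiff gelu (ℓ x + b) • c) ∈ Shallow X U := by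
  have h : ∀ b', (fun x => gelu (ℓ x + b') • c) ∈ Shallow X U := fun b' =>
    Submodule.subset_span ⟨ℓ, b', c, rfl⟩
  convert (Shallow X U).add_mem ((Shallow X U).sub_mem (h (b + 1))
    ((Shallow X U).smul_mem 2 (h b))) (h (b - 1)) using 1
  ext x
  simp only [secondDiff, Pi.add_apply, Pi.sub_apply, Pi.smul_apply, add_smul, sub_smul, mul_smul,
    add_assoc, add_sub_assoc]

theorem hasFDerivAt_secondDiff_gelu (ℓ : X →L[ℝ] ℝ) (b : ℝ) (c : U) (x : X) :
    HasFDerivAt (fun x => secondDiff gelu (ℓ x + b) • c)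
      ((secondDiff geluDeriv (ℓ x + b) • ℓ).smulRight c) x :=
  ((hasDerivAt_secondDiff hasDerivAt_gelu _).comp_hasFDerivAt x
    (ℓ.hasFDerivAt.add_const b)).smul_const c

theorem hasFDerivAt_cexp (ℓ : X →L[ℝ] ℝ) (c : ℂ) (x : X) :
    HasFDerivAt (fun x => Complex.exp ((ℓ x : ℝ) * Complex.I) * c)
      (ℓ.smulRight (Complex.exp ((ℓ x : ℝ) * Complex.I) * Complex.I * c)) x := by
  have h1 : HasDerivAt (fun t : ℝ => Complex.exp ((t : ℂ) * Complex.I) * c)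
      (Complex.exp ((ℓ x : ℝ) * Complex.I) * Complex.I * c) (ℓ x) := by
    have h2 : HasDerivAt (fun t : ℝ => (t : ℂ) * Complex.I) Complex.I (ℓ x) := by
      simpa using (Complex.ofRealCLM.hasDerivAt (x := ℓ x)).mul_const Complex.I
    exact h2.cexp.mul_const c
  refine (h1.hasFDerivAt.comp x ℓ.hasFDerivAt).congr_fderiv ?_
  ext v
  simp

variable [FiniteDimensional ℝ X]

/-- With `g = secondDiff gelu`, translation gives `∫ g (s - ℓ x / w) exp (i w s) ds = I exp (i ℓ x)`
with `I ≠ 0`, a superposition of shallow networks. Quadratic decay of `g` and `g'` dominates the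
integrand on balls. -/
theorem approximable_cexp (ℓ : X →L[ℝ] ℝ) (a : ℂ) :
    Approximable (fun x => Complex.exp ((ℓ x : ℝ) * Complex.I) * a) := by
  obtain ⟨w, hw, hI⟩ := exists_fourier_secondDiff_gelu_ne_zero
  set I : ℂ := ∫ s : ℝ, Complex.exp ((w * s : ℝ) * Complex.I) * (secondDiff gelu s : ℂ) with hIdef
  set ℓ' : X →L[ℝ] ℝ := -(w⁻¹ • ℓ) with hℓ'
  let F : ℝ → X → ℂ := fun s x =>
    secondDiff gelu (ℓ' x + s) • (Complex.exp ((w * s : ℝ) * Complex.I) * (I⁻¹ * a))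
  have hF' : ∀ s x, HasFDerivAt (F s) _ x := fun s x => hasFDerivAt_secondDiff_gelu ℓ' s _ x
  have hint : (fun x => Complex.exp ((ℓ x : ℝ) * Complex.I) * a) = fun x => ∫ s, F s x := by
    ext x
    have h1 : ∫ s, F s x = ∫ s : ℝ, F (s - ℓ' x) x := (integral_sub_right_eq_self _ _).symm
    have h2 : ∀ s : ℝ, F (s - ℓ' x) x = (Complex.exp ((w * s : ℝ) * Complex.I) *
        (secondDiff gelu s : ℂ)) * (Complex.exp ((ℓ x : ℝ) * Complex.I) * (I⁻¹ * a)) := by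
      intro s
      have h3 : w * (s - ℓ' x) = w * s + ℓ x := by
        simp only [hℓ', _root_.neg_apply, _root_.smul_apply, smul_eq_mul]
        field_simp
        ring
      simp only [F, add_sub_cancel, h3, Complex.real_smul]
      rw [Complex.ofReal_add, add_mul, Complex.exp_add]
      ring
    rw [h1, integral_congr_ae (ae_of_all _ h2), integral_mul_const, ← hIdef]
    field_simp
  rw [hint]
  have hexp : ∀ t : ℝ, ‖Complex.exp ((t : ℝ) * Complex.I)‖ = 1 := Complex.norm_exp_ofReal_mul_I
  refine approximable_integral (fun s => approximable_of_mem_shallow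
    (secondDiff_gelu_mem_shallow ℓ' s _)) (fun s x => (hF' s x).differentiableAt) ?_ ?_ ?_
  · have := continuous_secondDiff contDiff_gelu.continuous
    simp only [F]
    fun_prop
  · have := continuous_secondDiff continuous_geluDeriv
    rw [show (fun q : ℝ × X => fderiv ℝ (F q.1) q.2) = _ from
      funext fun q : ℝ × X => (hF' q.1 q.2).fderiv]
    have h1 : ∀ (r : ℝ) (z : ℂ), (r • ℓ').smulRight z = r • ℓ'.smulRight z := by
      intro r z
      ext v
      simp [mul_assoc]
    have h2 : ∀ z : ℂ, ℓ'.smulRight z = ContinuousLinearMap.smulRightL ℝ X ℂ ℓ' z := fun z => rfl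
    simp only [h1, h2]
    fun_prop
  · intro R
    set D := ‖ℓ'‖ * |R| with hD
    refine ⟨fun s => (6 * 800 * (2 + 2 * D ^ 2) * (1 + ‖ℓ'‖) * ‖I⁻¹ * a‖) * (1 + s ^ 2)⁻¹,
      integrable_inv_one_add_sq.const_mul _, fun s x hx => ?_⟩
    have ht : |ℓ' x| ≤ D := by
      exact (ℓ'.le_opNorm x).trans
        (mul_le_mul_of_nonneg_left (hx.trans (le_abs_self R)) (norm_nonneg _))
    have ht2 : (ℓ' x) ^ 2 ≤ D ^ 2 := sq_le_sq' (abs_le.1 ht).1 (abs_le.1 ht).2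
    have h1 : 6 * 800 / (1 + (ℓ' x + s) ^ 2) ≤ 6 * 800 * (2 + 2 * D ^ 2) * (1 + s ^ 2)⁻¹ := by
      rw [← div_eq_mul_inv, div_le_div_iff₀ (by positivity) (by positivity)]
      have h4 : s ^ 2 ≤ 2 * (ℓ' x + s) ^ 2 + 2 * D ^ 2 := by nlinarith [sq_nonneg (2 * ℓ' x + s)]
      have h5 : 0 ≤ D ^ 2 * (ℓ' x + s) ^ 2 := by positivity
      nlinarith [sq_nonneg (ℓ' x + s)]
    have hpos : 0 ≤ 6 * 800 * (2 + 2 * D ^ 2) * (1 + s ^ 2)⁻¹ := by positivity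
    have key : ∀ v N : ℝ, 0 ≤ N → N ≤ 1 + ‖ℓ'‖ → |v| ≤ 6 * 800 / (1 + (ℓ' x + s) ^ 2) →
        |v| * N * ‖I⁻¹ * a‖ ≤
          (6 * 800 * (2 + 2 * D ^ 2) * (1 + ‖ℓ'‖) * ‖I⁻¹ * a‖) * (1 + s ^ 2)⁻¹ := by
      intro v N hN hN' hv
      calc |v| * N * ‖I⁻¹ * a‖
          ≤ (6 * 800 * (2 + 2 * D ^ 2) * (1 + s ^ 2)⁻¹) * (1 + ‖ℓ'‖) * ‖I⁻¹ * a‖ := by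
            gcongr
            exact hv.trans h1
        _ = _ := by ring
    constructor
    · have := key _ 1 zero_le_one (by linarith [norm_nonneg ℓ']) (abs_secondDiff_gelu_le _)
      simp only [F]
      rwa [norm_smul, norm_mul, hexp, one_mul, Real.norm_eq_abs, ← mul_one (|_|)]
    · rw [(hF' s x).fderiv, ContinuousLinearMap.norm_smulRight_apply, norm_smul, norm_mul, hexp,
        one_mul]
      exact key _ _ (norm_nonneg _) (by linarith) (abs_secondDiff_geluDeriv_le _)

variable [MeasurableSpace X] [BorelSpace X]

-- Fourier inversion writes `ρ` as an integral of plane waves. Its transform is Schwartz, so its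
-- first moment is finite and dominates the derivatives.
open FourierTransform in
theorem approximable_of_smooth_hasCompactSupport {ρ : X → ℝ} (hρ : ContDiff ℝ (⊤ : ℕ∞) ρ)
    (hs : HasCompactSupport ρ) : Approximable ρ := by
  let f : SchwartzMap X ℂ := HasCompactSupport.toSchwartzMap (f := fun x => (ρ x : ℂ))
    (hs.comp_left (g := fun t : ℝ => (t : ℂ)) rfl) (Complex.ofRealCLM.contDiff.comp hρ)
  let k : SchwartzMap X ℂ := 𝓕 f
  let ℓ : X → X →L[ℝ] ℝ := fun ξ => (2 * Real.pi) • innerSL ℝ ξ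
  have hℓ : Continuous ℓ := by fun_prop
  have hrep : (fun x => (ρ x : ℂ)) = fun x => ∫ ξ, Complex.exp ((ℓ ξ x : ℝ) * Complex.I) * k ξ := by
    have h1 : 𝓕⁻ k = f := FourierTransform.fourierInv_fourier_eq f
    ext x
    have h2 : (ρ x : ℂ) = (𝓕⁻ k) x := by rw [h1]; rfl
    rw [h2, SchwartzMap.fourierInv_coe, Real.fourierInv_eq']
    rfl
  have hℓn : ∀ ξ, ‖ℓ ξ‖ = 2 * Real.pi * ‖ξ‖ := by
    intro ξ
    rw [norm_smul, innerSL_apply_norm, Real.norm_of_nonneg (by positivity)]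
  have hexp : ∀ t : ℝ, ‖Complex.exp ((t : ℝ) * Complex.I)‖ = 1 := Complex.norm_exp_ofReal_mul_I
  have hA : Approximable (fun x => (ρ x : ℂ)) := by
    rw [hrep]
    refine approximable_integral (fun ξ => approximable_cexp (ℓ ξ) (k ξ))
      (fun ξ x => (hasFDerivAt_cexp _ _ x).differentiableAt) ?_ ?_ ?_
    · have := k.continuous
      fun_prop
    · rw [show (fun q : X × X => fderiv ℝ
        (fun x => Complex.exp ((ℓ q.1 x : ℝ) * Complex.I) * k q.1) q.2) = _ from
        funext fun q : X × X => (hasFDerivAt_cexp (ℓ q.1) (k q.1) q.2).fderiv]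
      have h2 : ∀ (m : X →L[ℝ] ℝ) (z : ℂ),
        m.smulRight z = ContinuousLinearMap.smulRightL ℝ X ℂ m z := fun m z => rfl
      have := k.continuous
      simp only [h2]
      fun_prop
    · intro R
      refine ⟨fun ξ => ‖k ξ‖ + 2 * Real.pi * (‖ξ‖ ^ 1 * ‖k ξ‖),
        k.integrable.norm.add ((k.integrable_pow_mul volume 1).const_mul _), fun ξ x _ => ?_⟩
      constructor
      · rw [norm_mul, hexp, one_mul]
        have : 0 ≤ 2 * Real.pi * (‖ξ‖ ^ 1 * ‖k ξ‖) := by positivity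
        linarith
      · rw [(hasFDerivAt_cexp _ _ x).fderiv, ContinuousLinearMap.norm_smulRight_apply, norm_mul,
          norm_mul, hexp, Complex.norm_I, hℓn]
        have := norm_nonneg (k ξ)
        linarith
  have hd : Differentiable ℝ fun x => (ρ x : ℂ) :=
    (Complex.ofRealCLM.contDiff.comp hρ).differentiable (by simp)
  simpa using hA.clm_comp hd Complex.reCLM

open scoped Convolution in
/-- Universal approximation: `C¹` functions with compact support can be approximated, together with
their derivatives, by networks with one hidden layer. -/
theorem approximable_of_contDiff_hasCompactSupport [CompleteSpace U] {f : X → U}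
    (hf : ContDiff ℝ 1 f) (hs : HasCompactSupport f) : Approximable f := by
  refine approximable_of_forall_exists fun R ε hε => ?_
  have hf' : Continuous (fderiv ℝ f) := hf.continuous_fderiv one_ne_zero
  obtain ⟨δ₁, hδ₁, h₁⟩ := Metric.uniformContinuous_iff.1
    (hs.uniformContinuous_of_continuous hf.continuous) ε hε
  obtain ⟨δ₂, hδ₂, h₂⟩ := Metric.uniformContinuous_iff.1
    ((hs.fderiv ℝ).uniformContinuous_of_continuous hf') ε hε
  have hδ : 0 < min δ₁ δ₂ := lt_min hδ₁ hδ₂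
  -- The support radius serves the uniform continuity of both `f` and its derivative.
  let φ : ContDiffBump (0 : X) := ⟨min δ₁ δ₂ / 2, min δ₁ δ₂, half_pos hδ, half_lt_self hδ⟩
  let ρ : X → ℝ := φ.normed volume
  have hρ : ContDiff ℝ (⊤ : ℕ∞) ρ := φ.contDiff_normed
  have hρs : HasCompactSupport ρ := φ.hasCompactSupport_normed
  have hρd : Differentiable ℝ ρ := hρ.differentiable (by simp)
  have hρi : LocallyIntegrable ρ volume := hρ.continuous.locallyIntegrable
  have hconv : (ρ ⋆[ContinuousLinearMap.lsmul ℝ ℝ, volume] f) = fun x => ∫ y, ρ (x - y) • f y := by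
    ext x
    rw [convolution_lsmul_swap]
  have hFd : ∀ y x, HasFDerivAt (fun x => ρ (x - y) • f y)
      ((fderiv ℝ ρ (x - y)).smulRight (f y)) x := fun y x =>
    (((hρd (x - y)).hasFDerivAt.comp x ((hasFDerivAt_id x).sub_const y)).smul_const (f y))
  refine ⟨ρ ⋆[ContinuousLinearMap.lsmul ℝ ℝ, volume] f, ?_, fun x _ => ⟨?_, ?_⟩⟩
  · rw [hconv]
    refine approximable_integral (fun y => ?_) (fun y x => (hFd y x).differentiableAt) ?_ ?_ ?_
    · have hρy : ContDiff ℝ (⊤ : ℕ∞) fun x => ρ (x - y) := hρ.comp (contDiff_id.sub contDiff_const)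
      refine (approximable_of_smooth_hasCompactSupport hρy ?_).clm_comp
        (hρy.differentiable (by simp)) (ContinuousLinearMap.toSpanSingleton ℝ (f y))
      exact hρs.comp_homeomorph (Homeomorph.subRight y)
    · have := hρ.continuous
      have := hf.continuous
      fun_prop
    · rw [show (fun q : X × X => fderiv ℝ (fun x => ρ (x - q.1) • f q.1) q.2) = _ from
        funext fun q : X × X => (hFd q.1 q.2).fderiv]
      have h2 : ∀ (m : X →L[ℝ] ℝ) (z : U),
        m.smulRight z = ContinuousLinearMap.smulRightL ℝ X U m z := fun m z => rfl
      have := hρ.continuous_fderiv (by simp)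
      have := hf.continuous
      simp only [h2]
      fun_prop
    · intro R
      obtain ⟨C, hC⟩ := hρs.exists_bound_of_continuous hρ.continuous
      obtain ⟨C', hC'⟩ := (hρs.fderiv ℝ).exists_bound_of_continuous
        (hρ.continuous_fderiv (by simp))
      have hi : Integrable f := hf.continuous.integrable_of_hasCompactSupport hs
      refine ⟨fun y => max C C' * ‖f y‖, hi.norm.const_mul _, fun y x _ => ⟨?_, ?_⟩⟩
      · rw [norm_smul]
        exact mul_le_mul_of_nonneg_right ((hC _).trans (le_max_left _ _)) (norm_nonneg _)
      · rw [(hFd y x).fderiv, ContinuousLinearMap.norm_smulRight_apply]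
        exact mul_le_mul_of_nonneg_right ((hC' _).trans (le_max_right _ _)) (norm_nonneg _)
  · rw [norm_sub_rev, ← dist_eq_norm]
    refine φ.dist_normed_convolution_le hf.continuous.aestronglyMeasurable fun y hy => (h₁ ?_).le
    exact lt_of_lt_of_le hy (min_le_left _ _)
  · have h3 : (ρ ⋆[(ContinuousLinearMap.lsmul ℝ ℝ).precompR X, volume] fderiv ℝ f) x
        = (ρ ⋆[ContinuousLinearMap.lsmul ℝ ℝ, volume] fderiv ℝ f) x := rfl
    rw [(hs.hasFDerivAt_convolution_right (ContinuousLinearMap.lsmul ℝ ℝ) hρi hf x).fderiv, h3,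
      norm_sub_rev, ← dist_eq_norm]
    refine φ.dist_normed_convolution_le hf'.aestronglyMeasurable fun y hy => (h₂ ?_).le
    exact lt_of_lt_of_le hy (min_le_right _ _)

end Density

end

/-! ### Truncated orthonormal expansions -/

section

open Set Filter Metric

section Bases

variable {X : Type*} [NormedAddCommGroup X] [InnerProductSpace ℝ X] {N : ℕ∞}

theorem orthonormal_basisVec (e : HilbertBasis (Idx N) ℝ X) (r : ℕ) (hr : (r : ℕ∞) ≤ N) :
    Orthonormal ℝ (basisVec e r hr) :=
  e.orthonormal.comp _ fun i j hij => Fin.ext (by simpa using hij)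

/-- `decode` as a continuous linear map. -/
noncomputable def decodeL (e : HilbertBasis (Idx N) ℝ X) (r : ℕ) (hr : (r : ℕ∞) ≤ N) :
    (Fin r → ℝ) →L[ℝ] X :=
  ∑ i, (ContinuousLinearMap.proj i).smulRight (basisVec e r hr i)

theorem decodeL_apply (e : HilbertBasis (Idx N) ℝ X) (r : ℕ) (hr : (r : ℕ∞) ≤ N) (c : Fin r → ℝ) :
    decodeL e r hr c = decode e r hr c := by
  simp [decodeL, decode]

theorem continuous_encode (e : HilbertBasis (Idx N) ℝ X) (r : ℕ) (hr : (r : ℕ∞) ≤ N) :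
    Continuous (encode e r hr) :=
  continuous_pi fun _ => continuous_id.inner continuous_const

theorem norm_decode_sq (e : HilbertBasis (Idx N) ℝ X) (r : ℕ) (hr : (r : ℕ∞) ≤ N)
    (c : Fin r → ℝ) : ‖decode e r hr c‖ ^ 2 = ∑ i, c i ^ 2 := by
  rw [← real_inner_self_eq_norm_sq, decode, (orthonormal_basisVec e r hr).inner_sum]
  simp [sq]

theorem norm_decode_le_sum (e : HilbertBasis (Idx N) ℝ X) (r : ℕ) (hr : (r : ℕ∞) ≤ N)
    (c : Fin r → ℝ) : ‖decode e r hr c‖ ≤ ∑ i, |c i| := by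
  refine (norm_sum_le _ _).trans (Finset.sum_le_sum fun i _ => ?_)
  rw [norm_smul, (orthonormal_basisVec e r hr).1 i, mul_one, Real.norm_eq_abs]

/-- Bessel's inequality; it makes coordinatewise clipping norm-nonincreasing, which yields the
dominating function. -/
theorem norm_decode_le_of_abs_le_encode (e : HilbertBasis (Idx N) ℝ X) (r : ℕ)
    (hr : (r : ℕ∞) ≤ N) (x : X) {c : Fin r → ℝ} (hc : ∀ i, |c i| ≤ |encode e r hr x i|) :
    ‖decode e r hr c‖ ≤ ‖x‖ := by
  refine le_of_sq_le_sq ?_ (norm_nonneg x)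
  rw [norm_decode_sq]
  calc ∑ i, c i ^ 2 ≤ ∑ i, ‖inner ℝ (basisVec e r hr i) x‖ ^ 2 := by
        refine Finset.sum_le_sum fun i _ => ?_
        rw [← sq_abs (c i), real_inner_comm, Real.norm_eq_abs]
        exact pow_le_pow_left₀ (abs_nonneg _) (hc i) 2
    _ ≤ ‖x‖ ^ 2 := (orthonormal_basisVec e r hr).sum_inner_products_le x

/-- The rank `min k N`. -/
noncomputable def truncRank (N : ℕ∞) (k : ℕ) : ℕ := (min (k : ℕ∞) N).toNat

theorem coe_truncRank (N : ℕ∞) (k : ℕ) : (truncRank N k : ℕ∞) = min (k : ℕ∞) N :=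
  ENat.natCast_toNat (ne_top_of_le_ne_top (ENat.natCast_ne_top k) (min_le_left _ _))

theorem truncRank_le (N : ℕ∞) (k : ℕ) : (truncRank N k : ℕ∞) ≤ N :=
  (coe_truncRank N k).trans_le (min_le_right _ _)

/-- The initial index sets exhaust `Idx N`, so the unconditional basis expansion converges along
them. -/
theorem tendsto_decode_encode (e : HilbertBasis (Idx N) ℝ X) (x : X) :
    Tendsto (fun k => decode e (truncRank N k) (truncRank_le N k)
      (encode e (truncRank N k) (truncRank_le N k) x)) atTop (𝓝 x) := by
  let emb : ∀ k, Fin (truncRank N k) ↪ Idx N := fun k =>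
    ⟨fun i => ⟨i, lt_of_lt_of_le (by exact_mod_cast i.isLt) (truncRank_le N k)⟩,
      fun i j hij => Fin.ext (by simpa using hij)⟩
  have hmem : ∀ k (i : Idx N), i ∈ Finset.univ.map (emb k) ↔ (i : ℕ) < truncRank N k := by
    intro k i
    simp only [Finset.mem_map, Finset.mem_univ, true_and]
    constructor
    · rintro ⟨j, rfl⟩
      exact j.isLt
    · exact fun h => ⟨⟨i, h⟩, rfl⟩
  have hlt : ∀ k (i : Idx N), (i : ℕ) < truncRank N k ↔ (i : ℕ) < k := by
    intro k i
    have h : ((i : ℕ) : ℕ∞) < truncRank N k ↔ ((i : ℕ) : ℕ∞) < k := by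
      rw [coe_truncRank, lt_min_iff]
      exact and_iff_left i.2
    exact_mod_cast h
  have hs : Tendsto (fun k => Finset.univ.map (emb k)) atTop atTop := by
    refine tendsto_atTop_finset_of_monotone (fun k l hkl i hi => ?_) fun i => ⟨i + 1, ?_⟩
    · rw [hmem, hlt] at hi ⊢
      omega
    · rw [hmem, hlt]
      omega
  refine ((e.hasSum_repr x).comp hs).congr fun k => ?_
  simp only [Function.comp, Finset.sum_map, decode, encode, e.repr_apply_apply, basisVec]
  refine Finset.sum_congr rfl fun i _ => ?_
  rw [real_inner_comm]
  rfl

theorem exists_forall_norm_sub_decode_le (e : HilbertBasis (Idx N) ℝ X) {n : ℕ} (c : Fin n → X)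
    {η : ℝ} (hη : 0 < η) : ∃ (r : ℕ) (hr : (r : ℕ∞) ≤ N) (Y : Fin n → Fin r → ℝ),
      ∀ i, ‖c i - decode e r hr (Y i)‖ ≤ η := by
  have h : ∀ᶠ k in atTop, ∀ i, ‖c i - decode e (truncRank N k) (truncRank_le N k)
      (encode e (truncRank N k) (truncRank_le N k) (c i))‖ < η := by
    refine eventually_all.2 fun i => ?_
    filter_upwards [Metric.tendsto_nhds.1 (tendsto_decode_encode e (c i)) η hη] with k hk
    rwa [← dist_eq_norm, dist_comm]
  obtain ⟨k, hk⟩ := h.exists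
  exact ⟨_, truncRank_le N k, _, fun i => (hk i).le⟩

end Bases

/-! ### Approximation on compact products -/

section Product

variable {E₁ E₂ U : Type*} [NormedAddCommGroup E₁] [InnerProductSpace ℝ E₁]
  [FiniteDimensional ℝ E₁] [NormedAddCommGroup E₂] [InnerProductSpace ℝ E₂]
  [FiniteDimensional ℝ E₂] [NormedAddCommGroup U]

theorem exists_smooth_cutoff {X : Type*} [NormedAddCommGroup X] [NormedSpace ℝ X]
    [FiniteDimensional ℝ X] {K O : Set X} (hK : IsCompact K) (hO : IsOpen O) (hKO : K ⊆ O) :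
    ∃ χ : X → ℝ, ContDiff ℝ 1 χ ∧ HasCompactSupport χ ∧ tsupport χ ⊆ O ∧
      ∀ᶠ x in 𝓝ˢ K, χ x = 1 := by
  obtain ⟨L, hL, hKL, hLO⟩ := exists_compact_between hK hO hKO
  obtain ⟨f, h1, h0, -⟩ := exists_contMDiffMap_one_nhds_of_subset_interior
    (modelWithCornersSelf ℝ X) (n := 1) hK.isClosed hKL
  have hsub : tsupport f ⊆ L := closure_minimal
    (fun x hx => by_contra fun hxL => hx (h0 x hxL)) hL.isClosed
  exact ⟨f, f.contMDiff.contDiff, hL.of_isClosed_subset (isClosed_tsupport _) hsub,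
    hsub.trans hLO, h1⟩

/-- `F` is smooth only over `B`, so it is multiplied by a cutoff supported there. The cutoff is 1 on
a neighbourhood of `K × Z`, hence derivatives agree too. The `L²` product supplies the inner product
used by Fourier inversion. -/
theorem exists_shallow_approx_prod [NormedSpace ℝ U] [CompleteSpace U] {F : E₁ → E₂ → U}
    {B Z : Set E₂} (hB : IsOpen B) (hF : ContDiffOn ℝ 1 (fun q : E₁ × E₂ => F q.1 q.2) (univ ×ˢ B))
    {K : Set E₁} (hK : IsCompact K) (hZ : IsCompact Z) (hZB : Z ⊆ B) {ε : ℝ} (hε : 0 < ε) :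
    ∃ h ∈ Shallow (WithLp 2 (E₁ × E₂)) U, ∀ x ∈ K, ∀ z ∈ Z,
      ‖F x z - h (WithLp.toLp 2 (x, z))‖ ≤ ε ∧
      ‖fderiv ℝ (F x) z - fderiv ℝ (fun z => h (WithLp.toLp 2 (x, z))) z‖ ≤ ε := by
  let e : WithLp 2 (E₁ × E₂) ≃L[ℝ] E₁ × E₂ := WithLp.prodContinuousLinearEquiv 2 ℝ E₁ E₂
  let K' : Set (WithLp 2 (E₁ × E₂)) := e.symm '' (K ×ˢ Z)
  let O : Set (WithLp 2 (E₁ × E₂)) := e ⁻¹' (univ ×ˢ B)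
  have hK' : IsCompact K' := (hK.prod hZ).image e.symm.continuous
  have hO : IsOpen O := (isOpen_univ.prod hB).preimage e.continuous
  have hKO : K' ⊆ O := by
    rintro _ ⟨q, hq, rfl⟩
    simpa [O] using hZB hq.2
  obtain ⟨χ, hχ, hχc, hχO, hχ1⟩ := exists_smooth_cutoff hK' hO hKO
  let f : WithLp 2 (E₁ × E₂) → U := fun w => χ w • F (e w).1 (e w).2
  have hf : ContDiff ℝ 1 f := by
    rw [contDiff_iff_contDiffAt]
    intro w
    by_cases hw : w ∈ tsupport χ
    · refine hχ.contDiffAt.smul ?_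
      exact ((hF.contDiffAt ((isOpen_univ.prod hB).mem_nhds (hχO hw))).comp w
        e.contDiff.contDiffAt)
    · have h0 : f =ᶠ[𝓝 w] fun _ => 0 := by
        filter_upwards [(isClosed_tsupport χ).isOpen_compl.mem_nhds hw] with y hy
        simp [f, image_eq_zero_of_notMem_tsupport hy]
      exact contDiffAt_const.congr_of_eventuallyEq h0
  have hfc : HasCompactSupport f := hχc.smul_right
  borelize (WithLp 2 (E₁ × E₂))
  obtain ⟨R, hR⟩ := hK'.isBounded.exists_norm_le
  obtain ⟨h, hh, hfh⟩ := approximable_of_contDiff_hasCompactSupport hf hfc R ε hε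
  refine ⟨h, hh, fun x hx z hz => ?_⟩
  have hmem : (WithLp.toLp 2 (x, z)) ∈ K' := ⟨(x, z), ⟨hx, hz⟩, rfl⟩
  have hloc : ∀ᶠ w in 𝓝 (WithLp.toLp 2 (x, z)), χ w = 1 := hχ1.filter_mono (nhds_le_nhdsSet hmem)
  obtain ⟨ha, hb⟩ := hfh _ (hR _ hmem)
  have hfx : f (WithLp.toLp 2 (x, z)) = F x z := by
    simp only [f, hloc.self_of_nhds, one_smul]
    rfl
  refine ⟨by rwa [hfx] at ha, ?_⟩
  let J : E₂ →L[ℝ] WithLp 2 (E₁ × E₂) :=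
    (e.symm : E₁ × E₂ →L[ℝ] WithLp 2 (E₁ × E₂)).comp (ContinuousLinearMap.inr ℝ E₁ E₂)
  have hJ : HasFDerivAt (fun z => WithLp.toLp 2 (x, z)) J z :=
    (e.symm : E₁ × E₂ →L[ℝ] WithLp 2 (E₁ × E₂)).hasFDerivAt.comp z
      (hasFDerivAt_prodMk_right x z)
  have hJn : ‖J‖ ≤ 1 := by
    refine J.opNorm_le_bound zero_le_one fun v => ?_
    rw [one_mul]
    have h0 : J v = WithLp.toLp 2 (0, v) := rfl
    simp [h0]
  have hd1 : fderiv ℝ (F x) z = (fderiv ℝ f (WithLp.toLp 2 (x, z))).comp J := by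
    have h1 : F x =ᶠ[𝓝 z] fun z => f (WithLp.toLp 2 (x, z)) := by
      filter_upwards [hJ.continuousAt.eventually hloc] with y hy
      simp only [f, hy, one_smul]
      rfl
    rw [h1.fderiv_eq]
    exact ((hf.differentiable one_ne_zero _).hasFDerivAt.comp z hJ).fderiv
  have hd2 : fderiv ℝ (fun z => h (WithLp.toLp 2 (x, z))) z
      = (fderiv ℝ h (WithLp.toLp 2 (x, z))).comp J :=
    (((contDiff_of_mem_shallow hh).differentiable one_ne_zero _).hasFDerivAt.comp z hJ).fderiv
  rw [hd1, hd2, ← ContinuousLinearMap.sub_comp]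
  calc _ ≤ ‖fderiv ℝ f (WithLp.toLp 2 (x, z)) - fderiv ℝ h (WithLp.toLp 2 (x, z))‖ * ‖J‖ :=
        ContinuousLinearMap.opNorm_comp_le _ _
    _ ≤ ε * 1 := mul_le_mul hb hJn J.opNorm_nonneg hε.le
    _ = ε := mul_one ε

theorem exists_sum_of_mem_shallow {X : Type*} [NormedAddCommGroup X] [InnerProductSpace ℝ X]
    [NormedSpace ℝ U] {h : X → U} (hh : h ∈ Shallow X U) :
    ∃ (n : ℕ) (ℓ : Fin n → X →L[ℝ] ℝ) (b : Fin n → ℝ) (c : Fin n → U),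
      h = fun x => ∑ i, gelu (ℓ i x + b i) • c i := by
  obtain ⟨n, a, g, rfl⟩ := Submodule.mem_span_set'.1 hh
  choose ℓ b c hg using fun i => (g i).2
  refine ⟨n, ℓ, b, fun i => a i • c i, ?_⟩
  ext x
  simp only [hg, Finset.sum_apply, Pi.smul_apply]
  exact Finset.sum_congr rfl fun i _ => smul_comm _ _ _

/-- The output weights of an approximating shallow network may be taken in the span of finitely many
vectors of a given orthonormal basis. -/
theorem exists_decode_approx_prod [InnerProductSpace ℝ U] [CompleteSpace U] {N : ℕ∞}
    (φ : HilbertBasis (Idx N) ℝ U) {F : E₁ → E₂ → U}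
    {B Z : Set E₂} (hB : IsOpen B) (hF : ContDiffOn ℝ 1 (fun q : E₁ × E₂ => F q.1 q.2) (univ ×ˢ B))
    {K : Set E₁} (hK : IsCompact K) (hZ : IsCompact Z) (hZB : Z ⊆ B) {ε : ℝ} (hε : 0 < ε) :
    ∃ (r : ℕ) (hr : (r : ℕ∞) ≤ N) (n : ℕ) (ℓ : Fin n → WithLp 2 (E₁ × E₂) →L[ℝ] ℝ)
      (b : Fin n → ℝ) (Y : Fin n → Fin r → ℝ), ∀ x ∈ K, ∀ z ∈ Z,
      ‖F x z - decode φ r hr (∑ i, gelu (ℓ i (WithLp.toLp 2 (x, z)) + b i) • Y i)‖ ≤ ε ∧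
      ‖fderiv ℝ (F x) z - fderiv ℝ (fun z => decode φ r hr
        (∑ i, gelu (ℓ i (WithLp.toLp 2 (x, z)) + b i) • Y i)) z‖ ≤ ε := by
  obtain ⟨h, hh, hFh⟩ := exists_shallow_approx_prod hB hF hK hZ hZB (half_pos hε)
  obtain ⟨n, ℓ, b, c, rfl⟩ := exists_sum_of_mem_shallow hh
  let e : WithLp 2 (E₁ × E₂) ≃L[ℝ] E₁ × E₂ := WithLp.prodContinuousLinearEquiv 2 ℝ E₁ E₂
  let J : E₂ →L[ℝ] WithLp 2 (E₁ × E₂) :=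
    (e.symm : E₁ × E₂ →L[ℝ] WithLp 2 (E₁ × E₂)).comp (ContinuousLinearMap.inr ℝ E₁ E₂)
  have hJ : ∀ x z, HasFDerivAt (fun z => WithLp.toLp 2 (x, z)) J z := fun x z =>
    (e.symm : E₁ × E₂ →L[ℝ] WithLp 2 (E₁ × E₂)).hasFDerivAt.comp z
      (hasFDerivAt_prodMk_right x z)
  let t : Fin n → E₁ × E₂ → ℝ := fun i q => ℓ i (e.symm q) + b i
  have ht : ∀ i, Continuous (t i) := fun i => by fun_prop
  have hN : ∀ (i : Fin n) (x z), HasFDerivAt (fun z => gelu (ℓ i (WithLp.toLp 2 (x, z)) + b i))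
      (geluDeriv (t i (x, z)) • (ℓ i).comp J) z := fun i x z =>
    (hasDerivAt_gelu _).comp_hasFDerivAt z (((ℓ i).hasFDerivAt.comp z (hJ x z)).add_const (b i))
  have hsum : ∀ (c : Fin n → U) (x z), HasFDerivAt
      (fun z => ∑ i, gelu (ℓ i (WithLp.toLp 2 (x, z)) + b i) • c i)
      (∑ i, (geluDeriv (t i (x, z)) • (ℓ i).comp J).smulRight (c i)) z := fun c x z =>
    HasFDerivAt.fun_sum fun i _ => (hN i x z).smul_const (c i)
  obtain ⟨M, hM⟩ : ∃ M, ∀ q ∈ K ×ˢ Z,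
      (∑ i, (|gelu (t i q)| + ‖geluDeriv (t i q) • (ℓ i).comp J‖)) ≤ M := by
    have hg := contDiff_gelu.continuous
    have hg' := continuous_geluDeriv
    have hcont : Continuous fun q =>
      ∑ i, (|gelu (t i q)| + ‖geluDeriv (t i q) • (ℓ i).comp J‖) := by
        refine continuous_finsetSum _ fun i _ => (hg.comp (ht i)).abs.add ?_
        simp only [norm_smul]
        exact (hg'.comp (ht i)).norm.mul continuous_const
    obtain ⟨M, hM⟩ := ((hK.prod hZ).image hcont).bddAbove
    exact ⟨M, fun q hq => hM ⟨q, hq, rfl⟩⟩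
  -- `M` bounds the total size of all neurons and their `z`-derivatives on `K × Z`, so this
  -- perturbation of the weights costs at most `ε / 2`.
  have hη : 0 < ε / 2 / (|M| + 1) := by positivity
  obtain ⟨r, hr, Y, hY⟩ := exists_forall_norm_sub_decode_le φ c hη
  refine ⟨r, hr, n, ℓ, b, Y, fun x hx z hz => ?_⟩
  have hdec : ∀ z, decode φ r hr (∑ i, gelu (ℓ i (WithLp.toLp 2 (x, z)) + b i) • Y i)
      = ∑ i, gelu (ℓ i (WithLp.toLp 2 (x, z)) + b i) • decode φ r hr (Y i) := by
    intro z
    simp only [← decodeL_apply, map_sum, map_smul]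
  have hMη : ∀ v : Fin n → ℝ, (∑ i, v i) ≤ M → (∑ i, v i * (ε / 2 / (|M| + 1))) ≤ ε / 2 := by
    intro v hv
    rw [← Finset.sum_mul, mul_div_assoc', div_le_iff₀ (by positivity)]
    nlinarith [le_abs_self M]
  have hMx := hM (x, z) ⟨hx, hz⟩
  rw [Finset.sum_add_distrib] at hMx
  have hp1 : 0 ≤ ∑ i, |gelu (t i (x, z))| := Finset.sum_nonneg fun i _ => abs_nonneg _
  have hp2 : 0 ≤ ∑ i, ‖geluDeriv (t i (x, z)) • (ℓ i).comp J‖ :=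
    Finset.sum_nonneg fun i _ => norm_nonneg _
  constructor
  · rw [hdec]
    refine (norm_sub_le_norm_sub_add_norm_sub _ _ _).trans
      ((add_le_add (hFh x hx z hz).1 ?_).trans_eq (add_halves ε))
    rw [← Finset.sum_sub_distrib]
    refine (norm_sum_le _ _).trans ((Finset.sum_le_sum fun i _ => ?_).trans
      (hMη (fun i => |gelu (t i (x, z))|) (by linarith)))
    rw [← smul_sub, norm_smul, Real.norm_eq_abs]
    exact mul_le_mul_of_nonneg_left (hY i) (abs_nonneg _)
  · simp only [hdec]
    have h2 := (hFh x hx z hz).2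
    rw [(hsum c x z).fderiv] at h2
    rw [(hsum _ x z).fderiv]
    refine (norm_sub_le_norm_sub_add_norm_sub _ _ _).trans
      ((add_le_add h2 ?_).trans_eq (add_halves ε))
    rw [← Finset.sum_sub_distrib]
    refine (norm_sum_le _ _).trans ((Finset.sum_le_sum fun i _ => ?_).trans
      (hMη (fun i => ‖geluDeriv (t i (x, z)) • (ℓ i).comp J‖) (by linarith)))
    have h3 : ∀ (m : E₂ →L[ℝ] ℝ) (v w : U), m.smulRight v - m.smulRight w = m.smulRight (v - w) := by
      intro m v w
      ext y
      simp [smul_sub]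
    rw [h3, ContinuousLinearMap.norm_smulRight_apply]
    exact mul_le_mul_of_nonneg_left (hY i) (norm_nonneg _)

end Product

end

/-! ### Hilbert–Schmidt norm -/

section

open Set Filter Metric

section HilbertSchmidt

variable {U : Type*} [NormedAddCommGroup U] [InnerProductSpace ℝ U] {d : ℕ}

theorem hsNorm_eq_norm (A : EuclideanSpace ℝ (Fin d) →L[ℝ] U) :
    hsNorm A = ‖WithLp.toLp 2 fun i => A (EuclideanSpace.basisFun (Fin d) ℝ i)‖ := by
  rw [PiLp.norm_eq_of_L2, hsNorm]

theorem hsNorm_nonneg (A : EuclideanSpace ℝ (Fin d) →L[ℝ] U) : 0 ≤ hsNorm A :=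
  Real.sqrt_nonneg _

theorem hsNorm_add_le (A A' : EuclideanSpace ℝ (Fin d) →L[ℝ] U) :
    hsNorm (A + A') ≤ hsNorm A + hsNorm A' := by
  simp only [hsNorm_eq_norm]
  exact norm_add_le (WithLp.toLp 2 fun i => A (EuclideanSpace.basisFun (Fin d) ℝ i))
    (WithLp.toLp 2 fun i => A' (EuclideanSpace.basisFun (Fin d) ℝ i))

theorem hsNorm_le (A : EuclideanSpace ℝ (Fin d) →L[ℝ] U) : hsNorm A ≤ √d * ‖A‖ := by
  rw [hsNorm, ← Real.sqrt_sq (norm_nonneg A), ← Real.sqrt_mul (Nat.cast_nonneg d)]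
  refine Real.sqrt_le_sqrt ?_
  calc ∑ i, ‖A (EuclideanSpace.basisFun (Fin d) ℝ i)‖ ^ 2 ≤ ∑ _i : Fin d, ‖A‖ ^ 2 := by
        refine Finset.sum_le_sum fun i _ => pow_le_pow_left₀ (norm_nonneg _) ?_ 2
        exact A.unit_le_opNorm _ ((EuclideanSpace.basisFun (Fin d) ℝ).orthonormal.1 i).le
    _ = d * ‖A‖ ^ 2 := by simp

end HilbertSchmidt

/-! ### Truncation of the encoded parameter -/

/-- Truncation of a real number to `[-k, k]`. -/
def clip (k t : ℝ) : ℝ := max (t + k) 0 - max (t - k) 0 - k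

theorem clip_eq {k t : ℝ} (h : |t| ≤ k) : clip k t = t := by
  obtain ⟨h1, h2⟩ := abs_le.1 h
  rw [clip, max_eq_left (by linarith), max_eq_right (by linarith)]
  ring

theorem abs_clip_le_abs {k t : ℝ} (hk : 0 ≤ k) : |clip k t| ≤ |t| := by
  rw [clip]
  rcases max_cases (t + k) 0 with ⟨h, h'⟩ | ⟨h, h'⟩ <;>
  rcases max_cases (t - k) 0 with ⟨h1, h1'⟩ | ⟨h1, h1'⟩ <;>
  rcases abs_cases t with ⟨h2, h2'⟩ | ⟨h2, h2'⟩ <;>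
  rw [h, h1, h2, abs_le] <;> constructor <;> linarith

theorem abs_clip_le {k t : ℝ} (hk : 0 ≤ k) : |clip k t| ≤ k := by
  rw [clip]
  rcases max_cases (t + k) 0 with ⟨h, h'⟩ | ⟨h, h'⟩ <;>
  rcases max_cases (t - k) 0 with ⟨h1, h1'⟩ | ⟨h1, h1'⟩ <;>
  rw [h, h1, abs_le] <;> constructor <;> linarith

theorem continuous_clip (k : ℝ) : Continuous (clip k) := by
  unfold clip
  fun_prop

/-- `clip` is a uniform limit of affine combinations of two GELU neurons. -/
theorem exists_gelu_approx_clip (k : ℝ) {η : ℝ} (hη : 0 < η) : ∃ l : ℝ, 0 < l ∧ ∀ t : ℝ,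
    |l⁻¹ * (gelu (l * t + l * k) - gelu (l * t + -(l * k))) + -k - clip k t| ≤ η := by
  obtain ⟨C, hC, hCb⟩ := exists_abs_gelu_sub_relu_le
  -- ReLU is positively homogeneous, so scaling by `l` divides the two errors of size `C` by `l`.
  have hl : 0 < 2 * C / η := by positivity
  refine ⟨2 * C / η, hl, fun t => ?_⟩
  set l := 2 * C / η with hldef
  have h : l⁻¹ * (gelu (l * t + l * k) - gelu (l * t + -(l * k))) + -k - clip k t =
      l⁻¹ * ((gelu (l * t + l * k) - max (l * t + l * k) 0)
        - (gelu (l * t + -(l * k)) - max (l * t + -(l * k)) 0)) := by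
    have h1 : max (l * t + l * k) 0 = l * max (t + k) 0 := by
      rw [mul_max_of_nonneg _ _ hl.le]
      ring_nf
    have h2 : max (l * t + -(l * k)) 0 = l * max (t - k) 0 := by
      rw [mul_max_of_nonneg _ _ hl.le]
      ring_nf
    rw [h1, h2, clip]
    field_simp
    ring
  rw [h, abs_mul, abs_of_pos (inv_pos.2 hl), inv_mul_le_iff₀ hl]
  calc _ ≤ C + C := (abs_sub _ _).trans (add_le_add (hCb _) (hCb _))
    _ = l * η := by
      rw [hldef]
      field_simp
      ring

/-- Dominated convergence, with one index `k` driving both rank and threshold. For `k ≥ ‖x‖` no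
coordinate is clipped, so the limit is that of the basis expansion. -/
theorem exists_truncation {M : Type*} [NormedAddCommGroup M] [InnerProductSpace ℝ M]
    [MeasurableSpace M] [BorelSpace M] {N : ℕ∞} (ψ : HilbertBasis (Idx N) ℝ M) {p : ℝ} (hp : 2 ≤ p)
    (μ : Measure M) [IsProbabilityMeasure μ] (hμ : Integrable (fun m : M => ‖m‖ ^ p) μ) (b : M)
    {δ : ℝ} (hδ : 0 < δ) : ∃ (r : ℕ) (hr : (r : ℕ∞) ≤ N) (k : ℕ),
      ∫⁻ m, ENNReal.ofReal
        (‖(m - b) - decode ψ r hr (fun i => clip k (encode ψ r hr (m - b) i))‖ ^ p) ∂μ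
          ≤ ENNReal.ofReal δ := by
  have hp0 : 0 < p := by linarith
  let T : ℕ → M → M := fun k x => decode ψ (truncRank N k) (truncRank_le N k)
    (fun i => clip k (encode ψ (truncRank N k) (truncRank_le N k) x i))
  have hT : ∀ k, Continuous (T k) := by
    intro k
    simp only [T, ← decodeL_apply]
    refine (decodeL ψ _ _).continuous.comp (continuous_pi fun i => (continuous_clip k).comp ?_)
    exact (continuous_apply i).comp (continuous_encode ψ _ _)
  have hTn : ∀ k x, ‖T k x‖ ≤ ‖x‖ := fun k x =>
    norm_decode_le_of_abs_le_encode ψ _ _ x fun i => abs_clip_le_abs (Nat.cast_nonneg k)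
  have hTlim : ∀ x, Tendsto (fun k => T k x) atTop (𝓝 x) := by
    intro x
    refine (tendsto_decode_encode ψ x).congr' ?_
    obtain ⟨k₀, hk₀⟩ := exists_nat_ge ‖x‖
    filter_upwards [eventually_ge_atTop k₀] with k hk
    simp only [T]
    congr 1
    ext i
    refine (clip_eq ?_).symm
    have h1 : |encode ψ (truncRank N k) (truncRank_le N k) x i| ≤ ‖x‖ := by
      refine (abs_real_inner_le_norm _ _).trans_eq ?_
      rw [(orthonormal_basisVec ψ _ _).1 i, mul_one]
    have h2 : (k₀ : ℝ) ≤ k := by exact_mod_cast hk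
    linarith
  have hlim : Tendsto (fun k => ∫⁻ m, ENNReal.ofReal (‖(m - b) - T k (m - b)‖ ^ p) ∂μ) atTop
      (𝓝 (∫⁻ _, 0 ∂μ)) := by
    refine tendsto_lintegral_of_dominated_convergence
      (fun m => ENNReal.ofReal ((4 : ℝ) ^ p * (‖m‖ ^ p + ‖b‖ ^ p))) (fun k => ?_) (fun k => ?_) ?_ ?_
    · refine ENNReal.measurable_ofReal.comp (Continuous.measurable ?_)
      have h1 : Continuous fun m : M => m - b := by fun_prop
      exact ((h1.sub ((hT k).comp h1)).norm).rpow_const fun _ => Or.inr hp0.le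
    · refine ae_of_all _ fun m => ENNReal.ofReal_le_ofReal ?_
      have h1 : ‖(m - b) - T k (m - b)‖ ≤ 4 * max ‖m‖ ‖b‖ := by
        have h2 := norm_sub_le (m - b) (T k (m - b))
        have h3 := hTn k (m - b)
        have h4 := norm_sub_le m b
        linarith [le_max_left ‖m‖ ‖b‖, le_max_right ‖m‖ ‖b‖]
      have h0 : 0 ≤ max ‖m‖ ‖b‖ := (norm_nonneg m).trans (le_max_left _ _)
      refine (Real.rpow_le_rpow (norm_nonneg _) h1 hp0.le).trans ?_
      rw [Real.mul_rpow (by norm_num) h0]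
      refine mul_le_mul_of_nonneg_left ?_ (by positivity)
      have hm := Real.rpow_nonneg (norm_nonneg m) p
      have hb := Real.rpow_nonneg (norm_nonneg b) p
      rcases max_cases ‖m‖ ‖b‖ with ⟨h, -⟩ | ⟨h, -⟩ <;> rw [h] <;> linarith
    · have h1 : Integrable (fun m : M => (4 : ℝ) ^ p * (‖m‖ ^ p + ‖b‖ ^ p)) μ :=
        (hμ.add (integrable_const _)).const_mul _
      exact h1.lintegral_lt_top.ne
    · refine ae_of_all _ fun m => ?_
      have h1 : Tendsto (fun k => ‖(m - b) - T k (m - b)‖) atTop (𝓝 0) := by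
        have := (tendsto_const_nhds.sub (hTlim (m - b)) :
          Tendsto (fun k => (m - b) - T k (m - b)) atTop (𝓝 ((m - b) - (m - b)))).norm
        simpa using this
      have h2 := (h1.rpow_const (Or.inr hp0.le) : Tendsto _ _ (𝓝 ((0 : ℝ) ^ p)))
      rw [Real.zero_rpow hp0.ne'] at h2
      simpa using ENNReal.tendsto_ofReal h2
  rw [lintegral_zero] at hlim
  obtain ⟨k, hk⟩ := (hlim.eventually_lt_const (ENNReal.ofReal_pos.2 hδ)).exists
  exact ⟨_, truncRank_le N k, k, hk.le⟩

/-! ### Realization by networks -/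

/-- `f` is computed by a GELU network with `L` hidden layers. -/
def IsNet (L n k : ℕ) (f : (Fin n → ℝ) → Fin k → ℝ) : Prop :=
  ∃ θ : NetParams L n k, θ.eval gelu = f

theorem isNet_output {n k : ℕ} (A : (Fin n → ℝ) →ₗ[ℝ] Fin k → ℝ) (b : Fin k → ℝ) :
    IsNet 0 n k (fun a => A a + b) := by
  refine ⟨.output (LinearMap.toMatrix' A) b, ?_⟩
  ext a
  simp [NetParams.eval, LinearMap.toMatrix'_mulVec]

theorem isNet_hidden {L n k : ℕ} {ι : Type*} [Fintype ι] [Nonempty ι]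
    (A : (Fin n → ℝ) →ₗ[ℝ] ι → ℝ) (b : ι → ℝ) (f : (ι → ℝ) → Fin k → ℝ)
    (hf : IsNet L (Fintype.card ι) k (fun y => f (fun i => y (Fintype.equivFin ι i)))) :
    IsNet (L + 1) n k (fun a => f (fun i => gelu (A a i + b i))) := by
  obtain ⟨θ, hθ⟩ := hf
  let e := Fintype.equivFin ι
  refine ⟨.hidden Fintype.card_pos
    (LinearMap.toMatrix' ((LinearMap.funLeft ℝ ℝ e.symm).comp A)) (b ∘ e.symm) θ, ?_⟩
  ext a
  simp [NetParams.eval, LinearMap.toMatrix'_mulVec, hθ, e, LinearMap.funLeft_apply]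

/-- A sum of GELU neurons of a coordinatewise difference of GELU neurons is a network with two
hidden layers. -/
theorem isNet_two {n q k : ℕ} (α s t s' t' o : Fin n → ℝ) (ℓ : Fin q → (Fin n → ℝ) →ₗ[ℝ] ℝ)
    (b : Fin q → ℝ) (Y : Fin q → Fin k → ℝ) :
    IsNet 2 n k (fun a => ∑ i, gelu (ℓ i (fun j => α j * (gelu (s j * a j + t j) -
      gelu (s' j * a j + t' j)) + o j) + b i) • Y i) := by
  -- The extra index `none` is a dummy neuron that keeps the width positive when `n = 0`; likewise
  -- below for `q = 0`.
  let A₁ : (Fin n → ℝ) →ₗ[ℝ] Option (Fin n × Bool) → ℝ := LinearMap.pi fun i =>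
    i.elim 0 fun j => (if j.2 then s j.1 else s' j.1) • LinearMap.proj j.1
  let b₁ : Option (Fin n × Bool) → ℝ := fun i =>
    i.elim 0 fun j => if j.2 then t j.1 else t' j.1
  let D : (Option (Fin n × Bool) → ℝ) →ₗ[ℝ] Fin n → ℝ := LinearMap.pi fun j =>
    α j • ((LinearMap.proj (some (j, true)) : (Option (Fin n × Bool) → ℝ) →ₗ[ℝ] ℝ) -
      LinearMap.proj (some (j, false)))
  let A₂ : (Option (Fin n × Bool) → ℝ) →ₗ[ℝ] Option (Fin q) → ℝ := LinearMap.pi fun i =>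
    i.elim 0 fun i => (ℓ i).comp D
  let b₂ : Option (Fin q) → ℝ := fun i => i.elim 0 fun i => ℓ i o + b i
  let A₃ : (Option (Fin q) → ℝ) →ₗ[ℝ] Fin k → ℝ :=
    ∑ i, (LinearMap.proj (some i)).smulRight (Y i)
  have h₃ : IsNet 0 (Fintype.card (Option (Fin q))) k
      (fun y => A₃ (fun i => y (Fintype.equivFin (Option (Fin q)) i))) := by
    have := isNet_output (A₃.comp (LinearMap.funLeft ℝ ℝ (Fintype.equivFin (Option (Fin q))))) 0
    simpa using! this
  have h₂ := isNet_hidden (A₂.comp (LinearMap.funLeft ℝ ℝ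
    (Fintype.equivFin (Option (Fin n × Bool))))) b₂ _ h₃
  have h₁ := isNet_hidden A₁ b₁ (fun y => A₃ fun i => gelu (A₂ y i + b₂ i)) h₂
  convert h₁ using 1
  ext a j
  have hD : ∀ y, (fun j => α j * (y (some (j, true)) - y (some (j, false))) + o j) = D y + o := by
    intro y
    ext j
    simp [D]
  have h : ∀ i, gelu (ℓ i (fun j => α j * (gelu (s j * a j + t j) -
      gelu (s' j * a j + t' j)) + o j) + b i)
      = gelu (A₂ (fun i => gelu (A₁ a i + b₁ i)) (some i) + b₂ (some i)) := by
    intro i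
    have := hD fun i => gelu (A₁ a i + b₁ i)
    simp only [A₁, b₁, LinearMap.pi_apply, Option.elim, LinearMap.smul_apply, LinearMap.proj_apply,
      smul_eq_mul, if_true, Bool.false_eq_true, if_false] at this
    rw [this, map_add, add_assoc]
    rfl
  simp [h, A₃]

end

/-! ### Error bookkeeping and assembly -/

section

open Set Filter Metric

/-- Pointwise `f ≤ max (2 κ e) (ε / 4)`, so the integral is at most `2 (ε / 4) ^ p`, and `4 ^ p ≥
4`. -/
theorem lintegral_rpow_affine_le {Ω : Type*} [MeasurableSpace Ω] {μ : Measure Ω}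
    [IsProbabilityMeasure μ] {p κ ε : ℝ} (hp : 2 ≤ p) (hκ : 0 < κ) (hε : 0 < ε) {e f : Ω → ℝ}
    (he : ∀ ω, 0 ≤ e ω)
    (hei : ∫⁻ ω, ENNReal.ofReal (e ω ^ p) ∂μ ≤ ENNReal.ofReal ((ε / (8 * κ)) ^ p))
    (hf : ∀ ω, 0 ≤ f ω) (hfe : ∀ ω, f ω ≤ κ * e ω + ε / 8) :
    ∫⁻ ω, ENNReal.ofReal (f ω ^ p) ∂μ ≤ ENNReal.ofReal (ε ^ p / 2) := by
  have hp0 : 0 < p := by linarith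
  have hpt : ∀ ω, f ω ^ p ≤ (2 * κ) ^ p * e ω ^ p + (ε / 4) ^ p := by
    intro ω
    have h1 : 0 ≤ (2 * κ) ^ p * e ω ^ p := by
      have := Real.rpow_nonneg (he ω) p
      positivity
    have h2 : 0 ≤ (ε / 4) ^ p := by positivity
    rcases le_total (κ * e ω) (ε / 8) with h | h
    · have : f ω ^ p ≤ (ε / 4) ^ p :=
        Real.rpow_le_rpow (hf ω) ((hfe ω).trans (by linarith)) hp0.le
      linarith
    · have : f ω ^ p ≤ (2 * κ * e ω) ^ p :=
        Real.rpow_le_rpow (hf ω) ((hfe ω).trans (by linarith)) hp0.le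
      rw [Real.mul_rpow (by positivity) (he ω)] at this
      linarith
  calc ∫⁻ ω, ENNReal.ofReal (f ω ^ p) ∂μ
      ≤ ∫⁻ ω, (ENNReal.ofReal ((2 * κ) ^ p) * ENNReal.ofReal (e ω ^ p)
          + ENNReal.ofReal ((ε / 4) ^ p)) ∂μ := by
        refine lintegral_mono fun ω => ?_
        rw [← ENNReal.ofReal_mul (by positivity), ← ENNReal.ofReal_add
          (mul_nonneg (by positivity) (Real.rpow_nonneg (he ω) p)) (by positivity)]
        exact ENNReal.ofReal_le_ofReal (hpt ω)
    _ = ENNReal.ofReal ((2 * κ) ^ p) * (∫⁻ ω, ENNReal.ofReal (e ω ^ p) ∂μ)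
          + ENNReal.ofReal ((ε / 4) ^ p) := by
        rw [lintegral_add_right _ measurable_const, lintegral_const_mul' _ _ ENNReal.ofReal_ne_top]
        simp
    _ ≤ ENNReal.ofReal ((2 * κ) ^ p) * ENNReal.ofReal ((ε / (8 * κ)) ^ p)
          + ENNReal.ofReal ((ε / 4) ^ p) := by gcongr
    _ = ENNReal.ofReal (2 * (ε / 4) ^ p) := by
        rw [← ENNReal.ofReal_mul (by positivity), ← Real.mul_rpow (by positivity) (by positivity),
          ← ENNReal.ofReal_add (by positivity) (by positivity)]
        congr 1
        rw [show 2 * κ * (ε / (8 * κ)) = ε / 4 by field_simp; norm_num]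
        ring
    _ ≤ ENNReal.ofReal (ε ^ p / 2) := by
        refine ENNReal.ofReal_le_ofReal ?_
        rw [Real.div_rpow hε.le (by norm_num)]
        have h4 : (4 : ℝ) ≤ 4 ^ p := by
          have := Real.rpow_le_rpow_of_exponent_le (show (1 : ℝ) ≤ 4 by norm_num)
            (show (1 : ℝ) ≤ p by linarith)
          rwa [Real.rpow_one] at this
        have h0 : 0 ≤ ε ^ p := by positivity
        rw [mul_div_assoc', div_le_div_iff₀ (by positivity) (by norm_num)]
        nlinarith

/-- The two blocks of a vector, as a point of a Euclidean product space. -/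
def splitL (r d : ℕ) : (Fin (r + d) → ℝ) →ₗ[ℝ]
    WithLp 2 (EuclideanSpace ℝ (Fin r) × EuclideanSpace ℝ (Fin d)) where
  toFun a := WithLp.toLp 2 (WithLp.toLp 2 fun i => a (Fin.castAdd d i),
    WithLp.toLp 2 fun j => a (Fin.natAdd r j))
  map_add' _ _ := rfl
  map_smul' _ _ := rfl

theorem splitL_apply {r d : ℕ} (a : Fin (r + d) → ℝ) :
    splitL r d a = WithLp.toLp 2 (WithLp.toLp 2 fun i => a (Fin.castAdd d i),
      WithLp.toLp 2 fun j => a (Fin.natAdd r j)) := rfl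

/-- A shallow network precomposed with approximate truncation of the first block of variables is a
network with two hidden layers. -/
theorem isNet_truncated {r d q k : ℕ} (l κ : ℝ)
    (ℓ : Fin q → WithLp 2 (EuclideanSpace ℝ (Fin r) × EuclideanSpace ℝ (Fin d)) →L[ℝ] ℝ)
    (b : Fin q → ℝ) (Y : Fin q → Fin k → ℝ) :
    ∃ θ : NetParams 2 (r + d) k, ∀ (x : Fin r → ℝ) (z : EuclideanSpace ℝ (Fin d)),
      θ.eval gelu (Fin.append x fun j => z j) = ∑ i, gelu (ℓ i (WithLp.toLp 2 (WithLp.toLp 2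
        (fun i => l⁻¹ * (gelu (l * x i + l * κ) - gelu (l * x i + -(l * κ))) + -κ), z)) + b i)
          • Y i := by
  -- The first block is the clipping pair; on the second, the parameters give `gelu z - gelu (-z)`.
  obtain ⟨θ, hθ⟩ := isNet_two (Fin.append (fun _ : Fin r => l⁻¹) (fun _ : Fin d => 1))
    (Fin.append (fun _ : Fin r => l) (fun _ : Fin d => 1))
    (Fin.append (fun _ : Fin r => l * κ) (fun _ : Fin d => 0))
    (Fin.append (fun _ : Fin r => l) (fun _ : Fin d => -1))
    (Fin.append (fun _ : Fin r => -(l * κ)) (fun _ : Fin d => 0))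
    (Fin.append (fun _ : Fin r => -κ) (fun _ : Fin d => 0))
    (fun i => (ℓ i : _ →ₗ[ℝ] ℝ).comp (splitL r d)) b Y
  refine ⟨θ, fun x z => ?_⟩
  rw [hθ]
  refine Finset.sum_congr rfl fun i _ => ?_
  simp only [LinearMap.comp_apply, splitL_apply, Fin.append_left, Fin.append_right, one_mul,
    neg_one_mul, add_zero, gelu_sub_gelu_neg]
  rfl

end

end RBNO

open RBNO in
theorem theorem3p1
    {M U : Type*}
    [NormedAddCommGroup M] [InnerProductSpace ℝ M] [CompleteSpace M]
    [TopologicalSpace.SeparableSpace M] [MeasurableSpace M] [BorelSpace M]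
    [NormedAddCommGroup U] [InnerProductSpace ℝ U] [CompleteSpace U]
    [TopologicalSpace.SeparableSpace U]
    {d : ℕ} (p : ℝ) (hp : 2 ≤ p)
    (μ : Measure M) [IsProbabilityMeasure μ]
    (Zad B : Set (EuclideanSpace ℝ (Fin d)))
    (u : M → EuclideanSpace ℝ (Fin d) → U)
    (hu : RBNO.SolutionOperatorAssumption p μ Zad B u)
    {N_M N_U : ℕ∞}
    (φ : HilbertBasis (RBNO.Idx N_U) ℝ U) (ψ : HilbertBasis (RBNO.Idx N_M) ℝ M)
    (b_u : U) (b_m : M) (ε : ℝ) (hε : 0 < ε) :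
    ∃ (r_m r_u : ℕ) (hr_m : (r_m : ℕ∞) ≤ N_M) (hr_u : (r_u : ℕ∞) ≤ N_U)
      (L : ℕ) (_ : 1 ≤ L) (θ : RBNO.NetParams L (r_m + d) r_u),
      (⨆ z ∈ Zad,
        ((∫⁻ m, ENNReal.ofReal
            (‖u m z - RBNO.rbno φ ψ b_u b_m r_m r_u hr_m hr_u θ m z‖ ^ p) ∂μ) +
          ∫⁻ m, ENNReal.ofReal
            (RBNO.hsNorm (RBNO.Dz u m z -
              RBNO.Dz (RBNO.rbno φ ψ b_u b_m r_m r_u hr_m hr_u θ) m z) ^ p) ∂μ))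
        ≤ ENNReal.ofReal (ε ^ p) := by
  obtain ⟨κ₁, hκ₁, hlip⟩ := hu.lipschitz
  obtain ⟨κ₂, hκ₂, hlipD⟩ := hu.lipschitz_Dz
  set κ := κ₁ + κ₂ with hκdef
  have hκ : 0 < κ := by positivity
  obtain ⟨r, hr, k, htrunc⟩ := exists_truncation ψ hp μ hu.moment b_m
    (show 0 < (ε / (8 * κ)) ^ p by positivity)
  set e : M → ℝ := fun m =>
    ‖(m - b_m) - decode ψ r hr (fun i => clip k (encode ψ r hr (m - b_m) i))‖ with he
  -- The bound 1 keeps the approximate clip in `[-(k + 1), k + 1]`; the other makes the total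
  -- coordinate error cost at most `ε / 16`.
  set η : ℝ := min 1 (ε / 16 / (κ * r + 1)) with hη
  have hη0 : 0 < η := by positivity
  have hκη : κ * (r * η) ≤ ε / 16 := by
    have h1 : η ≤ ε / 16 / (κ * r + 1) := min_le_right _ _
    rw [le_div_iff₀ (by positivity)] at h1
    nlinarith
  obtain ⟨l, hl, hclip⟩ := exists_gelu_approx_clip (k : ℝ) hη0
  let T : ℝ → ℝ := fun t => l⁻¹ * (gelu (l * t + l * k) - gelu (l * t + -(l * k))) + -k
  have hT : ∀ t, |T t - clip k t| ≤ η := hclip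
  let F : EuclideanSpace ℝ (Fin r) → EuclideanSpace ℝ (Fin d) → U := fun x z =>
    u (b_m + decode ψ r hr x) z - b_u
  have hF : ContDiffOn ℝ 1 (fun q : EuclideanSpace ℝ (Fin r) × EuclideanSpace ℝ (Fin d) =>
      F q.1 q.2) (Set.univ ×ˢ B) := by
    refine ContDiffOn.sub ?_ contDiffOn_const
    let D : EuclideanSpace ℝ (Fin r) →L[ℝ] M :=
      (decodeL ψ r hr).comp (EuclideanSpace.equiv (Fin r) ℝ : _ →L[ℝ] _)
    have hD : ContDiff ℝ 1 fun q : EuclideanSpace ℝ (Fin r) × EuclideanSpace ℝ (Fin d) =>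
        (b_m + D q.1, q.2) := by fun_prop
    refine (hu.contDiffOn.comp hD.contDiffOn fun q hq => ⟨Set.mem_univ _, hq.2⟩).congr
      fun q _ => ?_
    simp only [Function.comp, D, ContinuousLinearMap.comp_apply, decodeL_apply]
    rfl
  let K : Set (EuclideanSpace ℝ (Fin r)) :=
    WithLp.toLp 2 '' Set.Icc (fun _ => -((k : ℝ) + 1)) (fun _ => (k : ℝ) + 1)
  have hK : IsCompact K := isCompact_Icc.image (PiLp.continuous_toLp 2 _)
  -- The factor `1 + √d` pays for passing from operator norm to Hilbert–Schmidt norm.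
  have hε1 : 0 < ε / 16 / (1 + √d) := by positivity
  obtain ⟨r_u, hr_u, n, ℓ, b, Y, hnet⟩ := exists_decode_approx_prod φ hu.isOpen hF hK hu.isCompact
    hu.subset hε1
  obtain ⟨θ, hθ⟩ := isNet_truncated l k ℓ b Y
  refine ⟨r, r_u, hr, hr_u, 2, one_le_two, θ, ?_⟩
  let x : M → EuclideanSpace ℝ (Fin r) := fun m =>
    WithLp.toLp 2 fun i => T (encode ψ r hr (m - b_m) i)
  -- Built from the approximate clip `T`, so `u (m' m) z - b_u` is exactly `F` at the point the
  -- second layer sees.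
  let m' : M → M := fun m => b_m + decode ψ r hr (x m)
  have hxK : ∀ m, x m ∈ K := by
    intro m
    have h : ∀ t, |T t| ≤ k + 1 := by
      intro t
      have h1 := abs_add_le (T t - clip k t) (clip k t)
      rw [sub_add_cancel] at h1
      have h2 := hT t
      have h3 : |clip k t| ≤ k := abs_clip_le (Nat.cast_nonneg k)
      have h4 : η ≤ 1 := min_le_left _ _
      linarith
    exact ⟨_, ⟨fun i => (abs_le.1 (h _)).1, fun i => (abs_le.1 (h _)).2⟩, rfl⟩
  have hdist : ∀ m, ‖m - m' m‖ ≤ e m + r * η := by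
    intro m
    have h1 : m - m' m = ((m - b_m) - decode ψ r hr fun i => clip k (encode ψ r hr (m - b_m) i)) -
        decode ψ r hr fun i => T (encode ψ r hr (m - b_m) i)
          - clip k (encode ψ r hr (m - b_m) i) := by
      have h2 := map_sub (decodeL ψ r hr) (fun i => T (encode ψ r hr (m - b_m) i))
        (fun i => clip k (encode ψ r hr (m - b_m) i))
      simp only [decodeL_apply] at h2
      rw [show (fun i => T (encode ψ r hr (m - b_m) i) - clip k (encode ψ r hr (m - b_m) i))
        = (fun i => T (encode ψ r hr (m - b_m) i)) -
          (fun i => clip k (encode ψ r hr (m - b_m) i)) from rfl, h2]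
      simp only [m', x]
      abel
    rw [h1]
    refine (norm_sub_le _ _).trans (add_le_add le_rfl ((norm_decode_le_sum ψ r hr _).trans ?_))
    refine (Finset.sum_le_sum fun i _ => hT _).trans_eq ?_
    simp
  have hrbno : ∀ m, rbno φ ψ b_u b_m r r_u hr hr_u θ m = fun z =>
      decode φ r_u hr_u (∑ i, gelu (ℓ i (WithLp.toLp 2 (x m, z)) + b i) • Y i) + b_u := by
    intro m
    ext z
    rw [rbno, hθ]
  have hε1' : ε / 16 / (1 + √d) ≤ ε / 16 :=
    div_le_self (by positivity) (by linarith [Real.sqrt_nonneg (d : ℝ)])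
  have hε1'' : √d * (ε / 16 / (1 + √d)) ≤ ε / 16 := by
    rw [mul_div_assoc', div_le_iff₀ (by positivity)]
    nlinarith [Real.sqrt_nonneg (d : ℝ)]
  have hκd : ∀ m, κ * ‖m - m' m‖ ≤ κ * e m + ε / 16 := fun m =>
    (mul_le_mul_of_nonneg_left (hdist m) hκ.le).trans (by linarith)
  refine iSup₂_le fun z hz => ?_
  have hzB := hu.subset hz
  have hval : ∀ m, ‖u m z - rbno φ ψ b_u b_m r r_u hr hr_u θ m z‖ ≤ κ * e m + ε / 8 := by
    intro m
    have h1 := hlip z hzB z hzB (m' m) m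
    rw [sub_self, norm_zero, add_zero] at h1
    have h2 := (hnet (x m) (hxK m) z hz).1
    have h3 : u m z - rbno φ ψ b_u b_m r r_u hr hr_u θ m z = (u m z - u (m' m) z) + (F (x m) z -
        decode φ r_u hr_u (∑ i, gelu (ℓ i (WithLp.toLp 2 (x m, z)) + b i) • Y i)) := by
      simp only [hrbno, F, m']
      abel
    have h4 : κ₁ * ‖m - m' m‖ ≤ κ * ‖m - m' m‖ :=
      mul_le_mul_of_nonneg_right (by linarith) (norm_nonneg _)
    rw [h3]
    have := norm_add_le (u m z - u (m' m) z) (F (x m) z -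
        decode φ r_u hr_u (∑ i, gelu (ℓ i (WithLp.toLp 2 (x m, z)) + b i) • Y i))
    linarith [hκd m]
  have hder : ∀ m, hsNorm (Dz u m z - Dz (rbno φ ψ b_u b_m r r_u hr hr_u θ) m z)
      ≤ κ * e m + ε / 8 := by
    intro m
    have h1 := hlipD z hzB z hzB (m' m) m
    rw [sub_self, norm_zero, add_zero] at h1
    have h2 := (hnet (x m) (hxK m) z hz).2
    set A := fderiv ℝ (F (x m)) z - fderiv ℝ (fun z => decode φ r_u hr_u
      (∑ i, gelu (ℓ i (WithLp.toLp 2 (x m, z)) + b i) • Y i)) z with hA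
    have h3 : Dz u m z - Dz (rbno φ ψ b_u b_m r r_u hr hr_u θ) m z
        = (Dz u m z - Dz u (m' m) z) + A := by
      have h5 : Dz (rbno φ ψ b_u b_m r r_u hr hr_u θ) m z = fderiv ℝ (fun z => decode φ r_u hr_u
          (∑ i, gelu (ℓ i (WithLp.toLp 2 (x m, z)) + b i) • Y i)) z := by
        rw [Dz, hrbno, fderiv_add_const]
      have h6 : fderiv ℝ (F (x m)) z = Dz u (m' m) z := fderiv_sub_const b_u
      rw [h5, hA, h6]
      abel
    have h4 : κ₂ * ‖m - m' m‖ ≤ κ * ‖m - m' m‖ :=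
      mul_le_mul_of_nonneg_right (by linarith) (norm_nonneg _)
    rw [h3]
    have h7 := hsNorm_add_le (Dz u m z - Dz u (m' m) z) A
    have h8 := (hsNorm_le A).trans (mul_le_mul_of_nonneg_left h2 (Real.sqrt_nonneg _))
    linarith [hκd m]
  have he0 : ∀ m, 0 ≤ e m := fun m => norm_nonneg _
  refine (add_le_add
    (lintegral_rpow_affine_le hp hκ hε he0 htrunc (fun m => norm_nonneg _) hval)
    (lintegral_rpow_affine_le hp hκ hε he0 htrunc (fun m => hsNorm_nonneg _) hder)).trans ?_
  rw [← ENNReal.ofReal_add (by positivity) (by positivity), add_halves]
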